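/- Let $n,m\in\mathbb{N}$, let $H\in\mathbb{R}^{m\times n}$, let $\hat\mu_x\in\mathbb{R}^n$, $\hat\mu_w\in\mathbb{R}^m$, let $\hat\Sigma_x\in\mathbb{R}^{n\times n}$ and $\hat\Sigma_w\in\mathbb{R}^{m\times m}$ be symmetric positive semidefinite, and let $\rho_x>0$, $\rho_w>0$. Write $M^{1/2}$ for the positive semidefinite square root of a positive semidefinite matrix $M$, $\mathcal{N}(\mu,\Sigma)$ for the (possibly degenerate) normal distribution with mean $\mu$ and covariance matrix $\Sigma\succeq 0$, $\|\cdot\|$ for the Euclidean norm, and $W_2$ for the type-2 Wasserstein distance on $\mathbb{R}^d$, $W_2(P,P')=\inf_\pi\left(\int\|\xi_1-\xi_2\|^2\,\pi(\mathrm{d}\xi_1,\mathrm{d}\xi_2)\right)^{1/2}$, the infimum being over all couplings $\pi$ of $P$ and $P'$. (SDP) Let $v_{\mathrm{SDP}}$ be the optimal value of the semidefinite program in the variables $Q\in\mathbb{R}^{n\times n}$ symmetric, $S\in\mathbb{R}^{(n+m)\times(n+m)}$, $\Sigma_x,V_x\in\mathbb{R}^{n\times n}$, $\Sigma_w,V_w\in\mathbb{R}^{m\times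 m}$ $$ \begin{array}{cl} \sup\limits_{Q,S,\Sigma_x,\Sigma_w,V_x,V_w} & \operatorname{Tr}(Q)\\ \text{s.t.} & S\succeq 0,\ \Sigma_x\succeq 0,\ \Sigma_w\succeq 0,\ V_x\succeq 0,\ V_w\succeq 0,\\ & \begin{bmatrix} I_n & 0\\ H & I_m\end{bmatrix}\left(\begin{bmatrix}\Sigma_x & 0\\ 0 & \Sigma_w\end{bmatrix}+S\right)\begin{bmatrix} I_n & H^\top\\ 0 & I_m\end{bmatrix}-\begin{bmatrix} Q & 0\\ 0 & 0\end{bmatrix}\succeq 0,\\ & \begin{bmatrix}\hat\Sigma_x^{1/2}\Sigma_x\hat\Sigma_x^{1/2} & V_x\\ V_x & I_n\end{bmatrix}\succeq 0,\quad \begin{bmatrix}\hat\Sigma_w^{1/2}\Sigma_w\hat\Sigma_w^{1/2} & V_w\\ V_w & I_m\end{bmatrix}\succeq 0,\\ & \operatorname{Tr}\left(\begin{bmatrix} I_n & 0\\ 0 & 0\end{bmatrix}S\right)+\operatorname{Tr}(\Sigma_x+\hat\Sigma_x-2V_x)\le\rho_x^2,\\ & \operatorname{Tr}\left(\begin{bmatrix}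 0 & 0\\ 0 & I_m\end{bmatrix}S\right)+\operatorname{Tr}(\Sigma_w+\hat\Sigma_w-2V_w)\le\rho_w^2. \end{array} $$ (i) The optimal value of the finite-dimensional min–max problem $$ \inf_{A\in\mathbb{R}^{n\times m},\,b\in\mathbb{R}^n}\ \sup_{\mu_x,\mu_w,\Sigma_x,\Sigma_w}\ \operatorname{Tr}\left[(AH-I_n)\Sigma_x(AH-I_n)^\top+A\Sigma_wA^\top\right]+\left\|(AH-I_n)\mu_x+A\mu_w+b\right\|^2, $$ where the supremum is over $\mu_x\in\mathbb{R}^n$, $\mu_w\in\mathbb{R}^m$, $\Sigma_x\succeq0$, $\Sigma_w\succeq0$ with $$ \|\mu_x\|^2+\operatorname{Tr}\left[\Sigma_x+\hat\Sigma_x-2\left(\hat\Sigma_x^{1/2}\Sigma_x\hat\Sigma_x^{1/2}\right)^{1/2}\right]\le\rho_x^2,\qquad \|\mu_w\|^2+\operatorname{Tr}\left[\Sigma_w+\hat\Sigma_w-2\left(\hat\Sigma_w^{1/2}\Sigma_w\hat\Sigma_w^{1/2}\right)^{1/2}\right]\le\rho_w^2, $$ is equal to $v_{\mathrm{SDP}}$.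 (ii) The optimal value of the min–max problem over linear estimators and Gaussian distributions $$ \inf_{f}\ \sup_{P}\ \int_{\mathbb{R}^n\times\mathbb{R}^m}\left\|f(Hx+w)-x\right\|^2\,\mathrm{d}P(x,w), $$ where $f$ ranges over the maps $f(y)=Ay+b$ with $A\in\mathbb{R}^{n\times m}$, $b\in\mathbb{R}^n$, and $P$ over the products $P_x\times P_w$ of Gaussian distributions $P_x=\mathcal{N}(\mu_x,\Sigma_x)$ on $\mathbb{R}^n$ and $P_w=\mathcal{N}(\mu_w,\Sigma_w)$ on $\mathbb{R}^m$ with $W_2(P_x,\mathcal{N}(\hat\mu_x,\hat\Sigma_x))\le\rho_x$ and $W_2(P_w,\mathcal{N}(\hat\mu_w,\hat\Sigma_w))\le\rho_w$, is also equal to $v_{\mathrm{SDP}}$. -/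

import Mathlib

open MeasureTheory ProbabilityTheory
open scoped ENNReal MatrixOrder Matrix

namespace WDRE

/-- The space `ℝᵈ` with its Euclidean norm. -/
abbrev Vec (d : ℕ) : Type := EuclideanSpace ℝ (Fin d)

/-- The matrix-vector product `A x` for Euclidean vectors. -/
noncomputable def act {k d : ℕ} (A : Matrix (Fin k) (Fin d) ℝ) (x : Vec d) : Vec k :=
  WithLp.toLp 2 (A *ᵥ x.ofLp)

section Probabilistic

/-- The set `𝒫_d` of probability distributions on `ℝᵈ` with finite second moments. -/
def distributions (d : ℕ) : Set (Measure (Vec d)) :=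
  {P | IsProbabilityMeasure P ∧ ∫⁻ ξ, ‖ξ‖ₑ ^ 2 ∂P < ∞}

/-- The type-2 Wasserstein distance: the infimum, over all couplings `π` of `P` and `Q`, of
`(∫ ‖ξ₁ - ξ₂‖² dπ)^(1/2)`. -/
noncomputable def wasserstein2 {d : ℕ} (P Q : Measure (Vec d)) : ℝ≥0∞ :=
  ⨅ π ∈ {π : Measure (Vec d × Vec d) | π.map Prod.fst = P ∧ π.map Prod.snd = Q},
    (∫⁻ ξ, ‖ξ.1 - ξ.2‖ₑ ^ 2 ∂π) ^ (1 / 2 : ℝ)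

/-- The mean square error `∫ ‖f (H x + w) - x‖² dP(x, w)` of the estimator `f` under the joint
distribution `P` of the parameter `x` and the noise `w`. -/
noncomputable def mse {n m : ℕ} (H : Matrix (Fin m) (Fin n) ℝ) (f : Vec m → Vec n)
    (P : Measure (Vec n × Vec m)) : ℝ≥0∞ :=
  ∫⁻ p, ‖f (act H p.1 + p.2) - p.1‖ₑ ^ 2 ∂P

/-- The estimators of the form `f y = A y + b`. -/
def linearEstimators (n m : ℕ) : Set (Vec m → Vec n) :=
  {f | ∃ (A : Matrix (Fin n) (Fin m) ℝ) (b : Vec n), ∀ y, f y = act A y + b}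

/-- The Gaussian distributions (possibly degenerate) in the Wasserstein ball of radius `ρ` around
the Gaussian distribution with mean `μhat` and covariance matrix `Shat`. -/
def gaussianBall {d : ℕ} (μhat : Vec d) (Shat : Matrix (Fin d) (Fin d) ℝ) (ρ : ℝ) :
    Set (Measure (Vec d)) :=
  {P | P ∈ distributions d ∧
    wasserstein2 P (multivariateGaussian μhat Shat) ≤ ENNReal.ofReal ρ ∧
    ∃ (μ : Vec d) (S : Matrix (Fin d) (Fin d) ℝ), S.PosSemidef ∧ P = multivariateGaussian μ S}

/-- The ambiguity set of products `P_x × P_w` of Gaussian distributions whose factors lie in the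
Wasserstein balls around the nominal Gaussian distributions of `x` and `w`. -/
def gaussianAmbiguitySet {n m : ℕ}
    (μx : Vec n) (Sxhat : Matrix (Fin n) (Fin n) ℝ) (ρx : ℝ)
    (μw : Vec m) (Swhat : Matrix (Fin m) (Fin m) ℝ) (ρw : ℝ) : Set (Measure (Vec n × Vec m)) :=
  {P | ∃ Px ∈ gaussianBall μx Sxhat ρx, ∃ Pw ∈ gaussianBall μw Swhat ρw, P = Px.prod Pw}

/-- The optimal value of the min-max problem over linear estimators and Gaussian distributions:
`inf_{f linear} sup_{P} mse(f, P)`. -/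
noncomputable def linearGaussianValue {n m : ℕ} (H : Matrix (Fin m) (Fin n) ℝ)
    (μx : Vec n) (Sxhat : Matrix (Fin n) (Fin n) ℝ) (ρx : ℝ)
    (μw : Vec m) (Swhat : Matrix (Fin m) (Fin m) ℝ) (ρw : ℝ) : ℝ≥0∞ :=
  ⨅ f ∈ linearEstimators n m, ⨆ P ∈ gaussianAmbiguitySet μx Sxhat ρx μw Swhat ρw, mse H f P

end Probabilistic

section Parametrized

/-- The quantity `Tr[S + Ŝ - 2 (Ŝ^{1/2} S Ŝ^{1/2})^{1/2}]`; `CFC.sqrt` is the positive semidefinite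
square root of a positive semidefinite matrix. -/
noncomputable def covGap {d : ℕ} (S Shat : Matrix (Fin d) (Fin d) ℝ) : ℝ :=
  (S + Shat - (2 : ℝ) • CFC.sqrt (CFC.sqrt Shat * S * CFC.sqrt Shat)).trace

/-- The constraints on the shifted mean `μ` and the covariance matrix `S`. -/
def MomentFeasible {d : ℕ} (Shat : Matrix (Fin d) (Fin d) ℝ) (ρ : ℝ)
    (μ : Vec d) (S : Matrix (Fin d) (Fin d) ℝ) : Prop :=
  S.PosSemidef ∧ ‖μ‖ ^ 2 + covGap S Shat ≤ ρ ^ 2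

/-- The objective
`Tr[(AH - I) Sx (AH - I)ᵀ + A Sw Aᵀ] + ‖(AH - I) μx + A μw + b‖²`, where `μx`, `μw` and `b` are
the shifted means and the shifted offset. -/
noncomputable def minimaxObjective {n m : ℕ} (H : Matrix (Fin m) (Fin n) ℝ)
    (A : Matrix (Fin n) (Fin m) ℝ) (b : Vec n) (μx : Vec n) (μw : Vec m)
    (Sx : Matrix (Fin n) (Fin n) ℝ) (Sw : Matrix (Fin m) (Fin m) ℝ) : ℝ :=
  ((A * H - 1) * Sx * (A * H - 1)ᵀ + A * Sw * Aᵀ).trace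
    + ‖act (A * H - 1) μx + act A μw + b‖ ^ 2

/-- The optimal value of the parametrized min-max problem: the infimum over `(A, b)` of the
supremum over all feasible `(μx, μw, Sx, Sw)` of the objective. -/
noncomputable def minimaxValue {n m : ℕ} (H : Matrix (Fin m) (Fin n) ℝ)
    (Sxhat : Matrix (Fin n) (Fin n) ℝ) (ρx : ℝ)
    (Swhat : Matrix (Fin m) (Fin m) ℝ) (ρw : ℝ) : EReal :=
  ⨅ (A : Matrix (Fin n) (Fin m) ℝ) (b : Vec n),
    ⨆ (μx : Vec n) (μw : Vec m) (Sx : Matrix (Fin n) (Fin n) ℝ) (Sw : Matrix (Fin m) (Fin m) ℝ)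
      (_ : MomentFeasible Sxhat ρx μx Sx ∧ MomentFeasible Swhat ρw μw Sw),
      ((minimaxObjective H A b μx μw Sx Sw : ℝ) : EReal)

end Parametrized

section Semidefinite

/-- The constraints of the semidefinite program in the variables `Q, S, Sx, Sw, Vx, Vw`. -/
structure SDPFeasible {n m : ℕ} (H : Matrix (Fin m) (Fin n) ℝ)
    (Sxhat : Matrix (Fin n) (Fin n) ℝ) (ρx : ℝ)
    (Swhat : Matrix (Fin m) (Fin m) ℝ) (ρw : ℝ)
    (Q : Matrix (Fin n) (Fin n) ℝ) (S : Matrix (Fin n ⊕ Fin m) (Fin n ⊕ Fin m) ℝ)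
    (Sx : Matrix (Fin n) (Fin n) ℝ) (Sw : Matrix (Fin m) (Fin m) ℝ)
    (Vx : Matrix (Fin n) (Fin n) ℝ) (Vw : Matrix (Fin m) (Fin m) ℝ) : Prop where
  symm_Q : Q.IsSymm
  psd_S : S.PosSemidef
  psd_Sx : Sx.PosSemidef
  psd_Sw : Sw.PosSemidef
  psd_Vx : Vx.PosSemidef
  psd_Vw : Vw.PosSemidef
  schur : (Matrix.fromBlocks 1 0 H 1 * (Matrix.fromBlocks Sx 0 0 Sw + S)
      * Matrix.fromBlocks 1 Hᵀ 0 1 - Matrix.fromBlocks Q 0 0 0).PosSemidef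
  block_x : (Matrix.fromBlocks (CFC.sqrt Sxhat * Sx * CFC.sqrt Sxhat) Vx Vx 1).PosSemidef
  block_w : (Matrix.fromBlocks (CFC.sqrt Swhat * Sw * CFC.sqrt Swhat) Vw Vw 1).PosSemidef
  trace_x : ((Matrix.fromBlocks 1 0 0 0 : Matrix (Fin n ⊕ Fin m) (Fin n ⊕ Fin m) ℝ) * S).trace
      + (Sx + Sxhat - (2 : ℝ) • Vx).trace ≤ ρx ^ 2
  trace_w : ((Matrix.fromBlocks 0 0 0 1 : Matrix (Fin n ⊕ Fin m) (Fin n ⊕ Fin m) ℝ) * S).trace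
      + (Sw + Swhat - (2 : ℝ) • Vw).trace ≤ ρw ^ 2

/-- The optimal value of the semidefinite program: the supremum of `Tr Q`. -/
noncomputable def sdpValue {n m : ℕ} (H : Matrix (Fin m) (Fin n) ℝ)
    (Sxhat : Matrix (Fin n) (Fin n) ℝ) (ρx : ℝ)
    (Swhat : Matrix (Fin m) (Fin m) ℝ) (ρw : ℝ) : EReal :=
  ⨆ (Q : Matrix (Fin n) (Fin n) ℝ) (S : Matrix (Fin n ⊕ Fin m) (Fin n ⊕ Fin m) ℝ)
    (Sx : Matrix (Fin n) (Fin n) ℝ) (Sw : Matrix (Fin m) (Fin m) ℝ)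
    (Vx : Matrix (Fin n) (Fin n) ℝ) (Vw : Matrix (Fin m) (Fin m) ℝ)
    (_ : SDPFeasible H Sxhat ρx Swhat ρw Q S Sx Sw Vx Vw), ((Q.trace : ℝ) : EReal)

end Semidefinite

end WDRE

/-! In the semidefinite program, `S` relaxes the rank-one matrix `μ μᵀ` of the shifted mean `μ =
(μx, μw)`, `Vx` and `Vw` linearize the matrix square roots in `covGap`, and `Q` stands for the Schur
complement left after minimizing over `A`.

SDP below min-max (`exists_momentFeasible_of_sdpFeasible`): fix `A` and `b`. Congruence of the Schur
constraint by `[-1, A]` bounds `Tr Q` by the quadratic error with second moments `diag(Sx, Sw) + S`.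
Only two traces of `S` are constrained, so `exists_vectors_of_posSemidef` replaces `S` by a single
vector, depending on `A`, without lowering the error. The sign of that vector is free, so the offset
`b` cannot help the estimator.

Min-max below SDP (`exists_sdpFeasible`): take `b = 0`. The relaxed set is convex and compact, and
the lifted error is convex in `A` and affine in the relaxed variables. If every `A` admits a
response of value at least `c`, then `exists_forall_le_of_forall_exists_le` gives one relaxed point
that works against all `A`. Against it the optimal `A` leaves the Schur complement as error
(`exists_estimator_of_posSemidef`), and that is a feasible `Q`.

Part (ii) reduces to the same two facts: Gelbrich's formula (`wasserstein2_multivariateGaussian`)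
turns the Wasserstein balls into moment constraints, the mean square error depends only on first and
second moments, and the offset absorbs the nominal means. -/

namespace WDRE

/-! ### Pseudo-inverses, Schur complements and extremal traces. -/

section MatrixAlgebra

set_option linter.unusedSectionVars false

variable {ι κ : Type*} [Fintype ι] [DecidableEq ι] [Fintype κ] [DecidableEq κ]

/-- A positive semidefinite real matrix has a symmetric pseudo-inverse commuting with it. -/
lemma exists_pseudoInverse {M : Matrix ι ι ℝ} (hM : M.PosSemidef) :
    ∃ P : Matrix ι ι ℝ, P.PosSemidef ∧ M * P * M = M ∧ P * M * P = P ∧ P * M = M * P := by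
  have hsa : IsSelfAdjoint M := hM.isHermitian.isSelfAdjoint
  have hf : (spectrum ℝ M).Finite := Matrix.finite_real_spectrum
  have hc : ContinuousOn (fun x : ℝ => x⁻¹) (spectrum ℝ M) := hf.continuousOn _
  have hi : ContinuousOn (fun x : ℝ => x) (spectrum ℝ M) := continuousOn_id
  have hid : M = cfc (fun x : ℝ => x) M := (cfc_id' ℝ M).symm
  -- The convention `0⁻¹ = 0` makes `x * x⁻¹ * x = x` hold at zero too; continuity on the finite
  -- spectrum is automatic.
  refine ⟨cfc (fun x : ℝ => x⁻¹) M, ?_, ?_, ?_, ?_⟩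
  · rw [← Matrix.nonneg_iff_posSemidef]
    exact cfc_nonneg fun x hx => inv_nonneg.2 (spectrum_nonneg_of_nonneg hM.nonneg hx)
  · conv_lhs => rw [hid]
    rw [cfc_id' ℝ M]
    conv_lhs =>
      lhs
      lhs
      rw [hid]
    conv_lhs =>
      rhs
      rw [hid]
    rw [← cfc_mul _ _ M hi hc, ← cfc_mul _ _ M (hf.continuousOn _) hi]
    conv_rhs => rw [hid]
    congr 1
    ext x
    rcases eq_or_ne x 0 with rfl | h
    · simp
    · field_simp
  · conv_lhs =>
      lhs
      rhs
      rw [hid]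
    rw [← cfc_mul _ _ M hc hi, ← cfc_mul _ _ M (hf.continuousOn _) hc]
    congr 1
    ext x
    rcases eq_or_ne x 0 with rfl | h
    · simp
    · field_simp
  · simpa only [cfc_id' ℝ M] using
      (cfc_commute_cfc (fun x : ℝ => x⁻¹) (fun x : ℝ => x) M).eq

lemma PosSemidef.transpose_eq {M : Matrix ι ι ℝ} (hM : M.PosSemidef) : Mᵀ = M := by
  simpa using hM.isHermitian.eq

lemma PosSemidef.mul_mul_transpose {M : Matrix ι ι ℝ} (hM : M.PosSemidef) (B : Matrix κ ι ℝ) :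
    (B * M * Bᵀ).PosSemidef := by
  simpa using hM.mul_mul_conjTranspose_same B

lemma posSemidef_sqrt (M : Matrix ι ι ℝ) : (CFC.sqrt M).PosSemidef :=
  Matrix.nonneg_iff_posSemidef.1 (CFC.sqrt_nonneg M)

lemma sqrt_mul_sqrt {M : Matrix ι ι ℝ} (hM : M.PosSemidef) : CFC.sqrt M * CFC.sqrt M = M :=
  CFC.sqrt_mul_sqrt_self M hM.nonneg

lemma transpose_sqrt (M : Matrix ι ι ℝ) : (CFC.sqrt M)ᵀ = CFC.sqrt M :=
  PosSemidef.transpose_eq (posSemidef_sqrt M)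

/-- The generalized Schur complement of a positive semidefinite block matrix. -/
lemma posSemidef_schurComplement {A : Matrix ι ι ℝ} {C : Matrix ι κ ℝ} {D P : Matrix κ κ ℝ}
    (h : (Matrix.fromBlocks A C Cᵀ D).PosSemidef) (hP : Pᵀ = P) (hPDP : P * D * P = P) :
    (A - C * P * Cᵀ).PosSemidef := by
  have := PosSemidef.mul_mul_transpose h (Matrix.fromCols 1 (-(C * P)))
  convert this using 1
  rw [Matrix.transpose_fromCols, Matrix.fromCols_mul_fromBlocks, Matrix.fromCols_mul_fromRows]
  have h1 : C * P * D * (P * Cᵀ) = C * P * Cᵀ := by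
    calc C * P * D * (P * Cᵀ) = C * (P * D * P) * Cᵀ := by simp only [Matrix.mul_assoc]
      _ = _ := by rw [hPDP]
  simp only [Matrix.transpose_one, Matrix.transpose_neg, Matrix.transpose_mul, hP, Matrix.one_mul,
    Matrix.mul_one, Matrix.add_mul, Matrix.mul_neg, Matrix.neg_mul, h1]
  rw [← Matrix.mul_assoc C P]
  abel

/-- The off-diagonal block of a positive semidefinite matrix factors through a diagonal block. -/
lemma mul_pseudoInverse_mul_of_posSemidef {A : Matrix ι ι ℝ} {C : Matrix ι κ ℝ}
    {D P : Matrix κ κ ℝ} (h : (Matrix.fromBlocks A C Cᵀ D).PosSemidef) (hDPD : D * P * D = D) :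
    C * P * D = C := by
  -- With `e = (1 - P D) v` in the kernel of `D`, the vector `(0, e)` has zero quadratic form, hence
  -- lies in the kernel of the block matrix, whose upper block gives `C e = 0`.
  have hE : ∀ v : κ → ℝ, (C * (1 - P * D)) *ᵥ v = 0 := by
    intro v
    set e : κ → ℝ := (1 - P * D) *ᵥ v with he
    have hDe : D *ᵥ e = 0 := by
      rw [he, Matrix.mulVec_mulVec, Matrix.mul_sub, ← Matrix.mul_assoc, hDPD]; simp
    have h0 : (Matrix.fromBlocks A C Cᵀ D) *ᵥ (Sum.elim 0 e) = Sum.elim (C *ᵥ e) 0 := by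
      rw [Matrix.fromBlocks_mulVec]
      simp [hDe]
    have h1 := (h.dotProduct_mulVec_zero_iff (Sum.elim 0 e)).1 (by
      rw [h0, star_trivial, dotProduct]; simp)
    rw [h0] at h1
    rw [← Matrix.mulVec_mulVec, ← he]
    ext i
    exact congrFun h1 (Sum.inl i)
  have : C * (1 - P * D) = 0 := by
    ext i j
    have := congrFun (hE (Pi.single j 1)) i
    simpa using this
  rw [Matrix.mul_sub, sub_eq_zero] at this
  rw [Matrix.mul_assoc, ← this, Matrix.mul_one]

/-- If `Y Yᵀ ≤ M`, then `Tr Y ≤ Tr M^{1/2}`. -/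
lemma trace_le_trace_sqrt {M Y : Matrix ι ι ℝ} (hM : M.PosSemidef)
    (h : (M - Y * Yᵀ).PosSemidef) : Y.trace ≤ (CFC.sqrt M).trace := by
  set N := CFC.sqrt M with hN
  have hNp : N.PosSemidef := posSemidef_sqrt M
  have hH := hNp.isHermitian
  -- Diagonals are compared in an eigenbasis of `N`: there `Z i i ^ 2 ≤ (Z Zᵀ) i i ≤ λ i ^ 2`.
  set U : Matrix ι ι ℝ := (hH.eigenvectorUnitary : Matrix ι ι ℝ) with hU
  have hUU : U * Uᵀ = 1 := by
    have := (Matrix.mem_unitaryGroup_iff).1 hH.eigenvectorUnitary.2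
    simpa [Matrix.star_eq_conjTranspose] using this
  have hUU' : Uᵀ * U = 1 := by
    have := (Matrix.mem_unitaryGroup_iff').1 hH.eigenvectorUnitary.2
    simpa [Matrix.star_eq_conjTranspose] using this
  have hspec : N = U * Matrix.diagonal hH.eigenvalues * Uᵀ := by
    have := hH.spectral_theorem
    simpa [Unitary.conjStarAlgAut_apply, Matrix.star_eq_conjTranspose, Function.comp_def] using this
  have hD : Uᵀ * N * U = Matrix.diagonal hH.eigenvalues := by
    calc Uᵀ * N * U = Uᵀ * (U * Matrix.diagonal hH.eigenvalues * Uᵀ) * U := by rw [← hspec]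
      _ = (Uᵀ * U) * Matrix.diagonal hH.eigenvalues * (Uᵀ * U) := by simp only [Matrix.mul_assoc]
      _ = _ := by rw [hUU']; simp
  have hcyc : ∀ Z : Matrix ι ι ℝ, Z.trace = (Uᵀ * Z * U).trace := by
    intro Z
    rw [Matrix.trace_mul_comm, ← Matrix.mul_assoc, hUU, Matrix.one_mul]
  set Z := Uᵀ * Y * U with hZ
  have hdiff : (Matrix.diagonal hH.eigenvalues * Matrix.diagonal hH.eigenvalues
      - Z * Zᵀ).PosSemidef := by
    have := PosSemidef.mul_mul_transpose h Uᵀ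
    convert this using 1
    rw [← hD, hZ, ← sqrt_mul_sqrt hM, ← hN]
    simp only [Matrix.transpose_mul, Matrix.transpose_transpose, Matrix.mul_sub, Matrix.sub_mul]
    congr 1
    · calc Uᵀ * N * U * (Uᵀ * N * U) = Uᵀ * N * (U * Uᵀ) * N * U := by simp only [Matrix.mul_assoc]
        _ = _ := by rw [hUU]; simp [Matrix.mul_assoc]
    · calc Uᵀ * Y * U * (Uᵀ * (Yᵀ * U)) = Uᵀ * Y * (U * Uᵀ) * Yᵀ * U := by
            simp only [Matrix.mul_assoc]
        _ = _ := by rw [hUU]; simp [Matrix.mul_assoc]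
  rw [hcyc Y, hcyc N, hD, ← hZ]
  refine Finset.sum_le_sum fun i _ => ?_
  have h1 := hdiff.diag_nonneg (i := i)
  simp only [Matrix.sub_apply, Matrix.diagonal_mul_diagonal, Matrix.diagonal_apply_eq,
    Matrix.mul_apply, Matrix.transpose_apply, sub_nonneg] at h1
  have h2 : Z i i * Z i i ≤ ∑ j, Z i j * Z i j :=
    Finset.single_le_sum (f := fun j => Z i j * Z i j) (fun j _ => mul_self_nonneg _)
      (Finset.mem_univ i)
  simp only [Matrix.diag_apply, Matrix.diagonal_apply_eq]
  exact abs_le_of_sq_le_sq' (by nlinarith) (hNp.eigenvalues_nonneg i) |>.2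

/-- The upper bound on the trace of a cross-covariance. -/
lemma trace_cross_le {S Sh C : Matrix ι ι ℝ}
    (h : (Matrix.fromBlocks S C Cᵀ Sh).PosSemidef) (hS : S.PosSemidef) (hSh : Sh.PosSemidef) :
    C.trace ≤ (CFC.sqrt (CFC.sqrt Sh * S * CFC.sqrt Sh)).trace := by
  obtain ⟨P, hP, h1, h2, -⟩ := exists_pseudoInverse hSh
  have hPt := PosSemidef.transpose_eq hP
  set G := CFC.sqrt Sh with hG
  have hGG : G * G = Sh := sqrt_mul_sqrt hSh
  have hGt : Gᵀ = G := transpose_sqrt Sh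
  have hC := mul_pseudoInverse_mul_of_posSemidef h h1
  -- `Y = G C P G` has the trace of `C`, and `Y Yᵀ = G (C P Cᵀ) G ≤ G S G` by the Schur complement.
  have ht : C.trace = (G * C * P * G).trace := by
    rw [Matrix.trace_mul_comm, ← Matrix.mul_assoc, ← Matrix.mul_assoc, hGG, Matrix.mul_assoc,
      Matrix.trace_mul_comm, hC]
  rw [ht]
  apply trace_le_trace_sqrt
  · simpa [hGt] using PosSemidef.mul_mul_transpose hS G
  · have := PosSemidef.mul_mul_transpose (posSemidef_schurComplement h hPt h2) G
    convert this using 1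
    simp only [Matrix.transpose_mul, hGt, hPt, Matrix.mul_sub, Matrix.sub_mul]
    congr 1
    calc G * C * P * G * (G * (P * (Cᵀ * G))) = G * C * (P * (G * G) * P) * (Cᵀ * G) := by
          simp only [Matrix.mul_assoc]
      _ = _ := by rw [hGG, h2]; simp only [Matrix.mul_assoc]

/-- A positive semidefinite coupling of two covariance matrices with maximal cross-trace. -/
lemma exists_cross_trace_eq {S Sh : Matrix ι ι ℝ} (hS : S.PosSemidef) (hSh : Sh.PosSemidef) :
    ∃ C : Matrix ι ι ℝ, (Matrix.fromBlocks S C Cᵀ Sh).PosSemidef ∧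
      C.trace = (CFC.sqrt (CFC.sqrt Sh * S * CFC.sqrt Sh)).trace := by
  set G := CFC.sqrt Sh with hG
  have hGG : G * G = Sh := sqrt_mul_sqrt hSh
  have hGt : Gᵀ = G := transpose_sqrt Sh
  have hSt := PosSemidef.transpose_eq hS
  have hGSG : (G * S * G).PosSemidef := by simpa [hGt] using PosSemidef.mul_mul_transpose hS G
  set N := CFC.sqrt (G * S * G) with hN
  have hNN : N * N = G * S * G := sqrt_mul_sqrt hGSG
  have hNt : Nᵀ = N := transpose_sqrt _
  obtain ⟨P, hP, h1, h2, h3⟩ := exists_pseudoInverse (posSemidef_sqrt (G * S * G))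
  rw [← hN] at h1 h2 h3
  have hPt := PosSemidef.transpose_eq hP
  -- The cross-covariance of `x` and `T x`, where `T = G P G` is the optimal transport map in the
  -- nondegenerate case. In general the image covariance `T S T` falls short of `Sh` by `G (1 - N P)
  -- G`, which is positive semidefinite because `1 - N P` is an orthogonal projection; this residual
  -- goes into the second block.
  refine ⟨S * (G * P * G), ?_, ?_⟩
  · set T := G * P * G with hT
    have hTt : Tᵀ = T := by simp [hT, hGt, hPt, Matrix.mul_assoc]
    have hTST : T * S * T = G * (N * P) * G := by
      calc T * S * T = G * P * (G * S * G) * P * G := by simp only [hT, Matrix.mul_assoc]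
        _ = G * (P * N) * (N * P) * G := by rw [← hNN]; simp only [Matrix.mul_assoc]
        _ = G * (N * P * N * P) * G := by rw [h3]; simp only [Matrix.mul_assoc]
        _ = _ := by rw [h1]
    have hres : (Sh - T * S * T).PosSemidef := by
      have h4 := PosSemidef.mul_mul_transpose
        (Matrix.posSemidef_self_mul_conjTranspose (1 - N * P)) G
      convert h4 using 1
      have : (1 - N * P) * (1 - N * P)ᵀ = 1 - N * P := by
        rw [Matrix.transpose_sub, Matrix.transpose_mul, hNt, hPt, h3]
        simp only [Matrix.transpose_one, Matrix.mul_sub, Matrix.sub_mul, Matrix.mul_one, Matrix.one_mul]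
        rw [← Matrix.mul_assoc, h1]; simp
      rw [Matrix.conjTranspose_eq_transpose_of_trivial, this, hGt, hTST]
      simp [Matrix.mul_sub, Matrix.sub_mul, hGG]
    have hsum := (PosSemidef.mul_mul_transpose hS (Matrix.fromRows 1 T)).add
      (PosSemidef.mul_mul_transpose hres (Matrix.fromRows (0 : Matrix ι ι ℝ) 1))
    convert hsum using 1
    simp only [Matrix.transpose_fromRows, Matrix.fromRows_mul _ _ S,
      Matrix.fromRows_mul _ _ (Sh - T * S * T), Matrix.fromRows_mul_fromCols, Matrix.fromBlocks_add]
    simp [hTt, hSt, Matrix.transpose_mul]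
  · calc (S * (G * P * G)).trace = (G * S * G * P).trace := by
          rw [Matrix.trace_mul_comm (G * S * G) P]
          rw [Matrix.trace_mul_comm]
          rw [Matrix.mul_assoc, Matrix.mul_assoc, Matrix.trace_mul_comm]
          simp only [Matrix.mul_assoc]
      _ = (N * (N * P)).trace := by rw [← hNN, Matrix.mul_assoc]
      _ = N.trace := by rw [Matrix.trace_mul_comm, h1]

lemma covGap_eq {d : ℕ} (S Sh : Matrix (Fin d) (Fin d) ℝ) :
    covGap S Sh = S.trace + Sh.trace
      - 2 * (CFC.sqrt (CFC.sqrt Sh * S * CFC.sqrt Sh)).trace := by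
  simp [covGap, Matrix.trace_sub, Matrix.trace_add, Matrix.trace_smul]

/-- Congruence of the extremal coupling by `[a, -b]` has nonnegative trace, and `a b = 1` makes its
cross term the one in `covGap`. The choice `(1, 1)` gives nonnegativity, and `(1/2, 2)` bounds `Tr
S`. -/
lemma covGap_lower_bound {d : ℕ} {S Sh : Matrix (Fin d) (Fin d) ℝ} (hS : S.PosSemidef)
    (hSh : Sh.PosSemidef) (a b : ℝ) (hab : a * b = 1) :
    (1 - a ^ 2) * S.trace + (1 - b ^ 2) * Sh.trace ≤ covGap S Sh := by
  obtain ⟨C, hC, hCt⟩ := exists_cross_trace_eq hS hSh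
  have h := (PosSemidef.mul_mul_transpose hC
    (Matrix.fromCols (a • (1 : Matrix (Fin d) (Fin d) ℝ)) (-(b • 1)))).trace_nonneg
  rw [Matrix.transpose_fromCols, Matrix.fromCols_mul_fromBlocks, Matrix.fromCols_mul_fromRows] at h
  simp [Matrix.trace_add, Matrix.trace_neg, Matrix.trace_smul] at h
  rw [covGap_eq, ← hCt]
  nlinarith [mul_assoc a b C.trace, congrArg (· * C.trace) hab]

lemma covGap_nonneg {d : ℕ} {S Sh : Matrix (Fin d) (Fin d) ℝ} (hS : S.PosSemidef)
    (hSh : Sh.PosSemidef) : 0 ≤ covGap S Sh := by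
  simpa using covGap_lower_bound hS hSh 1 1 (by norm_num)

/-- The entries of a positive semidefinite matrix are bounded by its trace. -/
lemma PosSemidef.abs_apply_le_trace {M : Matrix ι ι ℝ} (hM : M.PosSemidef) (i j : ι) :
    |M i j| ≤ M.trace := by
  have hd : ∀ k, M k k ≤ M.trace := fun k =>
    Finset.single_le_sum (f := fun k => M k k) (fun k _ => hM.diag_nonneg) (Finset.mem_univ k)
  have hs : M j i = M i j := congrFun (congrFun (PosSemidef.transpose_eq hM) i) j
  have key : ∀ s : ℝ, 0 ≤ M i i + s * (2 * M i j) + s ^ 2 * M j j := by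
    intro s
    have := hM.dotProduct_mulVec_nonneg (Pi.single i 1 + Pi.single j s)
    simp [Matrix.mulVec_add, add_dotProduct] at this
    rw [hs] at this
    linarith
  have h1 := key 1
  have h2 := key (-1)
  have := hd i
  have := hd j
  rw [abs_le]
  constructor <;> nlinarith

end MatrixAlgebra

/-! ### Merging vectors under two quadratic constraints. -/

section RankOne

variable {E F₁ F₂ F₃ : Type*} [AddCommGroup E] [Module ℝ E]
  [NormedAddCommGroup F₁] [InnerProductSpace ℝ F₁]
  [NormedAddCommGroup F₂] [InnerProductSpace ℝ F₂]
  [NormedAddCommGroup F₃] [InnerProductSpace ℝ F₃]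

lemma norm_sq_comb (L : E →ₗ[ℝ] F₁) (s t : E) (a b : ℝ) :
    ‖L (a • s + b • t)‖ ^ 2
      = a ^ 2 * ‖L s‖ ^ 2 + b ^ 2 * ‖L t‖ ^ 2 + 2 * a * b * inner ℝ (L s) (L t) := by
  rw [map_add, map_smul, map_smul, norm_add_sq_real, norm_smul, norm_smul, mul_pow, mul_pow,
    real_inner_smul_left, real_inner_smul_right, Real.norm_eq_abs, Real.norm_eq_abs, sq_abs, sq_abs]
  ring

/-- Two vectors may be replaced by a single one without increasing two quadratic forms and without
decreasing a third one. -/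
lemma exists_merge (X : E →ₗ[ℝ] F₁) (W : E →ₗ[ℝ] F₂) (q : E →ₗ[ℝ] F₃)
    (hq : ∀ v, X v = 0 → W v = 0 → q v = 0) (s t : E) :
    ∃ u : E, ‖X u‖ ^ 2 ≤ ‖X s‖ ^ 2 + ‖X t‖ ^ 2 ∧ ‖W u‖ ^ 2 ≤ ‖W s‖ ^ 2 + ‖W t‖ ^ 2 ∧
      ‖q s‖ ^ 2 + ‖q t‖ ^ 2 ≤ ‖q u‖ ^ 2 := by
  set A := ‖X s‖ ^ 2 + ‖X t‖ ^ 2 with hA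
  set B := ‖W s‖ ^ 2 + ‖W t‖ ^ 2 with hB
  set D := ‖q s‖ ^ 2 + ‖q t‖ ^ 2 with hD
  have hA0 : 0 ≤ A := by positivity
  have hB0 : 0 ≤ B := by positivity
  -- Rotating the pair `(s, t)` preserves the three sums of squares. A zero of `g` is an angle at
  -- which the two quadratic forms of `u`, and hence of `v`, are in the ratio `A : B`; it exists
  -- because `g 0 + g (π / 2) = 0`.
  set g : ℝ → ℝ := fun θ => ‖X (Real.cos θ • s + Real.sin θ • t)‖ ^ 2 * B
    - ‖W (Real.cos θ • s + Real.sin θ • t)‖ ^ 2 * A with hg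
  have hgc : Continuous g := by
    simp only [hg, norm_sq_comb]
    fun_prop
  have hg0 : g 0 + g (Real.pi / 2) = 0 := by
    simp [hg]
    ring_nf
    simp only [hA, hB]
    ring
  obtain ⟨θ, hθ⟩ : ∃ θ, g θ = 0 := by
    rcases le_total 0 (g 0) with h | h
    · exact mem_range_of_exists_le_of_exists_ge hgc ⟨Real.pi / 2, by linarith⟩ ⟨0, h⟩
    · exact mem_range_of_exists_le_of_exists_ge hgc ⟨0, h⟩ ⟨Real.pi / 2, by linarith⟩
  set u := Real.cos θ • s + Real.sin θ • t with hu
  set v := (-Real.sin θ) • s + Real.cos θ • t with hv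
  have hcs := Real.sin_sq_add_cos_sq θ
  have hX : ‖X u‖ ^ 2 + ‖X v‖ ^ 2 = A := by
    rw [hu, hv, norm_sq_comb, norm_sq_comb, hA]
    linear_combination (‖X s‖ ^ 2 + ‖X t‖ ^ 2) * hcs
  have hW : ‖W u‖ ^ 2 + ‖W v‖ ^ 2 = B := by
    rw [hu, hv, norm_sq_comb, norm_sq_comb, hB]
    linear_combination (‖W s‖ ^ 2 + ‖W t‖ ^ 2) * hcs
  have hQ : ‖q u‖ ^ 2 + ‖q v‖ ^ 2 = D := by
    rw [hu, hv, norm_sq_comb, norm_sq_comb, hD]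
    linear_combination (‖q s‖ ^ 2 + ‖q t‖ ^ 2) * hcs
  have hgu : ‖X u‖ ^ 2 * B = ‖W u‖ ^ 2 * A := sub_eq_zero.1 hθ
  have hgv : ‖X v‖ ^ 2 * B = ‖W v‖ ^ 2 * A := by
    have h1 : ‖X v‖ ^ 2 = A - ‖X u‖ ^ 2 := by linarith
    have h2 : ‖W v‖ ^ 2 = B - ‖W u‖ ^ 2 := by linarith
    rw [h1, h2]; linarith
  clear_value u v A B D g
  rcases (add_nonneg hA0 hB0).eq_or_lt with h0 | hpos
  · refine ⟨u, by nlinarith [sq_nonneg ‖X v‖], by nlinarith [sq_nonneg ‖W v‖], ?_⟩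
    have hAz : A = 0 := by linarith
    have hBz : B = 0 := by linarith
    have hz : ∀ w, ‖X w‖ ^ 2 ≤ A → ‖W w‖ ^ 2 ≤ B → q w = 0 := fun w h1 h2 => by
      apply hq
      · have : ‖X w‖ ^ 2 = 0 := le_antisymm (by linarith) (sq_nonneg _)
        simpa using this
      · have : ‖W w‖ ^ 2 = 0 := le_antisymm (by linarith) (sq_nonneg _)
        simpa using this
    have := hz v (by nlinarith [sq_nonneg ‖X u‖]) (by nlinarith [sq_nonneg ‖W u‖])
    rw [← hQ, this]; simp
  -- A balanced vector using a fraction `l` of both budgets can be scaled by `1 / √l` to exhaust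
  -- both. The fractions of `u` and `v` sum to one, so one of them carries at least its share of
  -- `D`.
  · have scale : ∀ w : E, ‖X w‖ ^ 2 * B = ‖W w‖ ^ 2 * A →
        (‖X w‖ ^ 2 + ‖W w‖ ^ 2) / (A + B) * D ≤ ‖q w‖ ^ 2 →
        0 < ‖X w‖ ^ 2 + ‖W w‖ ^ 2 →
        ∃ u : E, ‖X u‖ ^ 2 ≤ A ∧ ‖W u‖ ^ 2 ≤ B ∧ D ≤ ‖q u‖ ^ 2 := by
      intro w hw hqw hwpos
      set l := (‖X w‖ ^ 2 + ‖W w‖ ^ 2) / (A + B) with hl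
      have hlpos : 0 < l := div_pos hwpos hpos
      have h1 : ‖X w‖ ^ 2 = l * A := by
        rw [hl, div_mul_eq_mul_div, eq_div_iff hpos.ne']; linarith
      have h2 : ‖W w‖ ^ 2 = l * B := by
        rw [hl, div_mul_eq_mul_div, eq_div_iff hpos.ne']; linarith
      refine ⟨(Real.sqrt l)⁻¹ • w, ?_, ?_, ?_⟩
      · rw [map_smul, norm_smul, mul_pow, norm_inv, inv_pow, Real.norm_eq_abs, sq_abs,
          Real.sq_sqrt hlpos.le, h1]
        rw [inv_mul_cancel_left₀ hlpos.ne']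
      · rw [map_smul, norm_smul, mul_pow, norm_inv, inv_pow, Real.norm_eq_abs, sq_abs,
          Real.sq_sqrt hlpos.le, h2]
        rw [inv_mul_cancel_left₀ hlpos.ne']
      · rw [map_smul, norm_smul, mul_pow, norm_inv, inv_pow, Real.norm_eq_abs, sq_abs,
          Real.sq_sqrt hlpos.le, inv_mul_eq_div, le_div_iff₀ hlpos]
        linarith
    have hzero : ∀ w : E, ¬ 0 < ‖X w‖ ^ 2 + ‖W w‖ ^ 2 → ‖X w‖ ^ 2 = 0 ∧ ‖W w‖ ^ 2 = 0 ∧ q w = 0 := by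
      intro w hw
      have hx : ‖X w‖ ^ 2 = 0 := le_antisymm (by nlinarith [sq_nonneg ‖W w‖]) (sq_nonneg _)
      have hy : ‖W w‖ ^ 2 = 0 := le_antisymm (by nlinarith [sq_nonneg ‖X w‖]) (sq_nonneg _)
      exact ⟨hx, hy, hq w (by simpa using hx) (by simpa using hy)⟩
    by_cases hup : 0 < ‖X u‖ ^ 2 + ‖W u‖ ^ 2
    · by_cases hvp : 0 < ‖X v‖ ^ 2 + ‖W v‖ ^ 2
      · by_cases hcase : (‖X u‖ ^ 2 + ‖W u‖ ^ 2) / (A + B) * D ≤ ‖q u‖ ^ 2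
        · exact scale u hgu hcase hup
        · refine scale v hgv ?_ hvp
          have : (‖X u‖ ^ 2 + ‖W u‖ ^ 2) / (A + B) * D + (‖X v‖ ^ 2 + ‖W v‖ ^ 2) / (A + B) * D
              = D := by
            rw [← add_mul, ← add_div]
            have : ‖X u‖ ^ 2 + ‖W u‖ ^ 2 + (‖X v‖ ^ 2 + ‖W v‖ ^ 2) = A + B := by linarith
            rw [this, div_self hpos.ne', one_mul]
          push Not at hcase
          linarith
      · obtain ⟨h1, h2, h3⟩ := hzero v hvp
        exact ⟨u, by linarith, by linarith, by rw [← hQ, h3]; simp⟩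
    · obtain ⟨h1, h2, h3⟩ := hzero u hup
      exact ⟨v, by linarith, by linarith, by rw [← hQ, h3]; simp⟩

/-- Applied to the columns of a factor of a second-moment matrix, this is the reduction to rank one.
-/
lemma exists_merge_sum (X : E →ₗ[ℝ] F₁) (W : E →ₗ[ℝ] F₂) (q : E →ₗ[ℝ] F₃)
    (hq : ∀ v, X v = 0 → W v = 0 → q v = 0) {ι : Type*} (I : Finset ι) (s : ι → E) :
    ∃ u : E, ‖X u‖ ^ 2 ≤ ∑ i ∈ I, ‖X (s i)‖ ^ 2 ∧ ‖W u‖ ^ 2 ≤ ∑ i ∈ I, ‖W (s i)‖ ^ 2 ∧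
      ∑ i ∈ I, ‖q (s i)‖ ^ 2 ≤ ‖q u‖ ^ 2 := by
  classical
  induction I using Finset.induction_on with
  | empty => exact ⟨0, by simp⟩
  | insert a I ha ih =>
    obtain ⟨u, h1, h2, h3⟩ := ih
    obtain ⟨v, k1, k2, k3⟩ := exists_merge X W q hq (s a) u
    simp only [Finset.sum_insert ha]
    exact ⟨v, by linarith, by linarith, by linarith⟩

end RankOne

/-! ### Exactness of the rank-one relaxation. -/

section RankOneMatrix

variable {n m : ℕ}

lemma act_add {k d : ℕ} (A : Matrix (Fin k) (Fin d) ℝ) (x y : Vec d) :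
    act A (x + y) = act A x + act A y := by
  simp [act, Matrix.mulVec_add]

lemma act_smul {k d : ℕ} (A : Matrix (Fin k) (Fin d) ℝ) (c : ℝ) (x : Vec d) :
    act A (c • x) = c • act A x := by
  simp [act, Matrix.mulVec_smul]

/-- `act` as a linear map. -/
noncomputable def actLin {k d : ℕ} (A : Matrix (Fin k) (Fin d) ℝ) : Vec d →ₗ[ℝ] Vec k where
  toFun := act A
  map_add' := act_add A
  map_smul' := act_smul A

lemma trace_mul_self_transpose {κ ι : Type*} [Fintype κ] [Fintype ι] (M : Matrix κ ι ℝ) :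
    (M * Mᵀ).trace = ∑ j, ‖WithLp.toLp 2 (Mᵀ j)‖ ^ 2 := by
  simp only [Matrix.trace, Matrix.diag_apply, Matrix.mul_apply, Matrix.transpose_apply,
    EuclideanSpace.real_norm_sq_eq]
  rw [Finset.sum_comm]
  simp [sq]

/-- A second-moment matrix may be replaced by a single vector in the quadratic maximization with
two norm constraints. -/
lemma exists_vectors_of_posSemidef (B : Matrix (Fin n) (Fin n) ℝ) (A : Matrix (Fin n) (Fin m) ℝ)
    {S : Matrix (Fin n ⊕ Fin m) (Fin n ⊕ Fin m) ℝ} (hS : S.PosSemidef) :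
    ∃ (x : Vec n) (w : Vec m),
      ‖x‖ ^ 2 ≤ ((Matrix.fromBlocks 1 0 0 0 : Matrix (Fin n ⊕ Fin m) (Fin n ⊕ Fin m) ℝ) * S).trace ∧
      ‖w‖ ^ 2 ≤ ((Matrix.fromBlocks 0 0 0 1 : Matrix (Fin n ⊕ Fin m) (Fin n ⊕ Fin m) ℝ) * S).trace ∧
      (Matrix.fromCols B A * S * (Matrix.fromCols B A)ᵀ).trace ≤ ‖act B x + act A w‖ ^ 2 := by
  obtain ⟨R, hR⟩ : ∃ R : Matrix (Fin n ⊕ Fin m) (Fin n ⊕ Fin m) ℝ, S = R * Rᵀ := by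
    obtain ⟨R, hR⟩ := CStarAlgebra.nonneg_iff_eq_star_mul_self.mp hS.nonneg
    exact ⟨Rᵀ, by simpa [Matrix.star_eq_conjTranspose] using hR⟩
  -- The columns of `R`, split into blocks: since `S = R Rᵀ`, the three traces are sums of squared
  -- norms over them.
  let s : (Fin n ⊕ Fin m) → Vec n × Vec m := fun k =>
    (WithLp.toLp 2 fun i => R (Sum.inl i) k, WithLp.toLp 2 fun j => R (Sum.inr j) k)
  obtain ⟨u, h1, h2, h3⟩ := exists_merge_sum (LinearMap.fst ℝ (Vec n) (Vec m))
    (LinearMap.snd ℝ (Vec n) (Vec m))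
    ((actLin B).comp (LinearMap.fst ℝ _ _) + (actLin A).comp (LinearMap.snd ℝ _ _))
    (fun v h h' => by
      have h : v.1 = 0 := h
      have h' : v.2 = 0 := h'
      simp [h, h']) Finset.univ s
  refine ⟨u.1, u.2, h1.trans (le_of_eq ?_), h2.trans (le_of_eq ?_), le_trans (le_of_eq ?_) h3⟩
  · simp only [LinearMap.fst_apply, s, EuclideanSpace.real_norm_sq_eq]
    rw [Finset.sum_comm]
    have : ∀ i j : Fin n, (1 : Matrix (Fin n) (Fin n) ℝ) i j = if i = j then 1 else 0 :=
      fun i j => Matrix.one_apply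
    simp [Matrix.trace, Matrix.mul_apply, Fintype.sum_sum_type, hR, sq, this]
  · simp only [LinearMap.snd_apply, s, EuclideanSpace.real_norm_sq_eq]
    rw [Finset.sum_comm]
    have : ∀ i j : Fin m, (1 : Matrix (Fin m) (Fin m) ℝ) i j = if i = j then 1 else 0 :=
      fun i j => Matrix.one_apply
    simp [Matrix.trace, Matrix.mul_apply, Fintype.sum_sum_type, hR, sq, this]
  · have : Matrix.fromCols B A * S * (Matrix.fromCols B A)ᵀ
        = (Matrix.fromCols B A * R) * (Matrix.fromCols B A * R)ᵀ := by
      rw [hR, Matrix.transpose_mul]; simp only [Matrix.mul_assoc]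
    rw [this, trace_mul_self_transpose]
    refine Finset.sum_congr rfl fun k _ => ?_
    congr 2
    ext i
    simp [actLin, act, s, Matrix.mul_apply, Fintype.sum_sum_type, Matrix.mulVec, dotProduct]

end RankOneMatrix

/-! ### A minimax theorem by separation. -/

section Minimax

/-- A minimax theorem: if `K` is compact and convex, `f` is convex in its first argument and affine
and continuous in the second one, then the order of the quantifiers may be exchanged. -/
lemma exists_forall_le_of_forall_exists_le {E F : Type*} [AddCommGroup E] [Module ℝ E]
    [TopologicalSpace E] [AddCommGroup F] [Module ℝ F] {K : Set E} (hK : IsCompact K)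
    (hKc : Convex ℝ K) (f : F → E → ℝ) (hcont : ∀ A, Continuous (f A))
    (haff : ∀ A x y (a b : ℝ), f A (a • x + b • y) = a * f A x + b * f A y)
    (hconv : ∀ x ∈ K, ConvexOn ℝ Set.univ (fun A => f A x)) (c : ℝ)
    (h : ∀ A, ∃ x ∈ K, c ≤ f A x) : ∃ x ∈ K, ∀ A, c ≤ f A x := by
  classical
  have key : (K ∩ ⋂ A, {x | c ≤ f A x}).Nonempty := by
    -- By compactness, only finitely many `A` need to be met at once.
    refine hK.inter_iInter_nonempty _
      (fun A => isClosed_le continuous_const (hcont A)) fun u => ?_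
    by_contra hne
    -- The payoff vectors form a compact convex set `C`; if it misses the orthant `D`, a hyperplane
    -- separates the two strictly.
    set C : Set (u → ℝ) := (fun x (i : u) => f i x) '' K with hC
    set D : Set (u → ℝ) := {y | ∀ i, c ≤ y i} with hD
    have hCcomp : IsCompact C := hK.image (continuous_pi fun i => hcont i)
    have hCconv : Convex ℝ C := by
      rintro _ ⟨x, hx, rfl⟩ _ ⟨y, hy, rfl⟩ a b ha hb hab
      exact ⟨a • x + b • y, hKc hx hy ha hb hab, by ext i; simp [haff]⟩
    have hDconv : Convex ℝ D := by
      intro x hx y hy a b ha hb hab i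
      have := hx i
      have := hy i
      simp only [Pi.add_apply, Pi.smul_apply, smul_eq_mul]
      calc c = a * c + b * c := by rw [← add_mul, hab, one_mul]
        _ ≤ _ := by gcongr
    have hDcl : IsClosed D := by
      simp only [hD, Set.ofPred_forall]
      exact isClosed_iInter fun i => isClosed_le continuous_const (continuous_apply i)
    have hdisj : Disjoint C D := by
      rw [Set.disjoint_left]
      rintro _ ⟨x, hx, rfl⟩ hxD
      exact hne ⟨x, hx, by simpa using fun i hi => hxD ⟨i, hi⟩⟩
    obtain ⟨g, s, t, hgC, hst, hgD⟩ :=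
      geometric_hahn_banach_compact_closed hCconv hCcomp hDconv hDcl hdisj
    set w : u → ℝ := fun i => g (Pi.single i 1) with hw
    have hg : ∀ y : u → ℝ, g y = ∑ i, w i * y i := by
      intro y
      conv_lhs => rw [← Finset.univ_sum_single y]
      rw [map_sum]
      refine Finset.sum_congr rfl fun i _ => ?_
      have : (Pi.single i (y i) : u → ℝ) = y i • Pi.single i 1 := by
        rw [← Pi.single_smul]; simp
      rw [this, map_smul, smul_eq_mul, mul_comm]
    have hw0 : ∀ i, 0 ≤ w i := by
      intro i
      by_contra hneg
      push Not at hneg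
      -- A negative weight would let a point of `D`, moved by `r` in direction `i`, cross the
      -- hyperplane.
      set r : ℝ := |(g (fun _ => c) - t) / w i| with hr
      have h1 := hgD ((fun _ => c) + r • Pi.single i 1) (by
        intro j
        have : (0 : ℝ) ≤ (Pi.single i 1 : u → ℝ) j := by
          by_cases hij : j = i
          · subst hij; simp
          · simp [hij]
        simp only [Pi.add_apply, Pi.smul_apply, smul_eq_mul]
        nlinarith [abs_nonneg ((g (fun _ => c) - t) / w i)])
      rw [map_add, map_smul, smul_eq_mul] at h1
      have h2 : -((g (fun _ => c) - t) / w i) ≤ r := neg_le_abs _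
      have h3 : r * w i ≤ -((g (fun _ => c) - t) / w i) * w i :=
        mul_le_mul_of_nonpos_right h2 hneg.le
      have h4 : -((g (fun _ => c) - t) / w i) * w i = t - g (fun _ => c) := by
        rw [neg_mul, div_mul_cancel₀ _ hneg.ne]; ring
      have h5 : g (Pi.single i 1) = w i := rfl
      rw [h5] at h1
      linarith
    have hgc := hgD (fun _ => c) (fun _ => le_rfl)
    obtain ⟨x₀, hx₀, -⟩ := h 0
    have hWpos : 0 < ∑ i, w i := by
      rcases (Finset.sum_nonneg fun i _ => hw0 i : 0 ≤ ∑ i, w i).eq_or_lt with h0 | h0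
      · have hz := (Finset.sum_eq_zero_iff_of_nonneg fun i _ => hw0 i).1 h0.symm
        have hz' : ∀ y, g y = 0 := fun y => by
          rw [hg]; exact Finset.sum_eq_zero fun i hi => by rw [hz i hi, zero_mul]
        have := hgC _ ⟨x₀, hx₀, rfl⟩
        rw [hz'] at this hgc
        linarith
      · exact h0
    set W := ∑ i, w i with hW
    -- The normalized weights give an averaged `A`. By convexity, the response to it has weighted
    -- payoff at least `c`, contradicting the separation.
    obtain ⟨x, hx, hcx⟩ := h (∑ i, (w i / W) • (i : F))
    have h1 := (hconv x hx).map_sum_le (t := Finset.univ) (w := fun i => w i / W)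
      (p := fun i : u => (i : F)) (fun i _ => div_nonneg (hw0 i) hWpos.le)
      (by rw [← Finset.sum_div, div_self hWpos.ne']) (fun _ _ => Set.mem_univ _)
    have h2 : ∑ i, (w i / W) • f (i : F) x = g (fun i => f i x) / W := by
      rw [hg, Finset.sum_div]
      exact Finset.sum_congr rfl fun i _ => by rw [smul_eq_mul]; ring
    have h3 := hgC _ ⟨x, hx, rfl⟩
    rw [hg, ← Finset.sum_mul] at hgc
    have h4 : W * c ≤ g (fun i => f i x) := by
      rw [h2] at h1
      have := hcx.trans h1
      rw [le_div_iff₀ hWpos] at this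
      linarith
    simp only at h3
    linarith
  obtain ⟨x, hx, hx'⟩ := key
  exact ⟨x, hx, fun A => by simpa using Set.mem_iInter.1 hx' A⟩

end Minimax

/-! ### The relaxed feasible set: convexity and compactness. -/

section Relaxation

lemma isClosed_posSemidef {ι : Type*} [Fintype ι] :
    IsClosed {M : Matrix ι ι ℝ | M.PosSemidef} := by
  have : {M : Matrix ι ι ℝ | M.PosSemidef}
      = {M | Mᵀ = M} ∩ ⋂ x : ι → ℝ, {M | 0 ≤ x ⬝ᵥ M *ᵥ x} := by
    ext M
    simp [Matrix.posSemidef_iff_dotProduct_mulVec, Matrix.IsHermitian]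
  rw [this]
  refine (isClosed_eq (by fun_prop) continuous_id).inter (isClosed_iInter fun x => ?_)
  exact isClosed_le continuous_const (by fun_prop)

lemma PosSemidef.comb {ι : Type*} [Fintype ι] {M N : Matrix ι ι ℝ} (hM : M.PosSemidef)
    (hN : N.PosSemidef) {a b : ℝ} (ha : 0 ≤ a) (hb : 0 ≤ b) : (a • M + b • N).PosSemidef :=
  (hM.smul ha).add (hN.smul hb)

lemma isCompact_box (ι κ : Type*) (r : ℝ) :
    IsCompact {M : Matrix ι κ ℝ | ∀ i j, |M i j| ≤ r} := by
  have : {M : Matrix ι κ ℝ | ∀ i j, |M i j| ≤ r}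
      = Set.univ.pi fun _ : ι => Set.univ.pi fun _ : κ => Set.Icc (-r) r := by
    ext M
    refine ⟨fun h i _ j _ => abs_le.1 (h i j), fun h i j => abs_le.2 (h i trivial j trivial)⟩
  rw [this]
  exact isCompact_univ_pi fun i => isCompact_univ_pi fun j => isCompact_Icc

/-- The block constraint on `V` bounds its trace by the trace of the matrix square root. -/
lemma trace_le_trace_sqrt_of_block {ι : Type*} [Fintype ι] [DecidableEq ι] {M V : Matrix ι ι ℝ}
    (hM : M.PosSemidef) (hV : V.PosSemidef) (h : (Matrix.fromBlocks M V V 1).PosSemidef) :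
    V.trace ≤ (CFC.sqrt M).trace := by
  have hVt := PosSemidef.transpose_eq hV
  apply trace_le_trace_sqrt hM
  have h' : (Matrix.fromBlocks M V Vᵀ 1).PosSemidef := by rwa [hVt]
  simpa using posSemidef_schurComplement (P := 1) h' (by simp) (by simp)

/-- The block constraint amounts to `V² ≤ M`, so replacing the square root by `V` can only tighten
the moment constraint. -/
lemma covGap_le_of_block {d : ℕ} {S Sh V : Matrix (Fin d) (Fin d) ℝ} (hS : S.PosSemidef)
    (hV : V.PosSemidef)
    (h : (Matrix.fromBlocks (CFC.sqrt Sh * S * CFC.sqrt Sh) V V 1).PosSemidef) :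
    covGap S Sh ≤ (S + Sh - (2 : ℝ) • V).trace := by
  have hM : (CFC.sqrt Sh * S * CFC.sqrt Sh).PosSemidef := by
    simpa [transpose_sqrt] using PosSemidef.mul_mul_transpose hS (CFC.sqrt Sh)
  have := trace_le_trace_sqrt_of_block hM hV h
  rw [covGap_eq]
  simp [Matrix.trace_add, Matrix.trace_sub, Matrix.trace_smul]
  linarith

/-- The matrix is `[N; 1] [N; 1]ᵀ` with `N = √M`. So `V = √M` is admissible and the linearization
loses nothing. -/
lemma posSemidef_block_sqrt {ι : Type*} [Fintype ι] [DecidableEq ι] {M : Matrix ι ι ℝ}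
    (hM : M.PosSemidef) : (Matrix.fromBlocks M (CFC.sqrt M) (CFC.sqrt M) 1).PosSemidef := by
  have := Matrix.posSemidef_self_mul_conjTranspose (Matrix.fromRows (CFC.sqrt M) (1 : Matrix ι ι ℝ))
  convert this using 1
  rw [Matrix.conjTranspose_eq_transpose_of_trivial, Matrix.transpose_fromRows,
    Matrix.fromRows_mul_fromCols, transpose_sqrt, sqrt_mul_sqrt hM]
  simp

/-- The tuples `(S, Sx, Sw, Vx, Vw)` satisfying all constraints of the semidefinite program that do
not involve `Q`. -/
structure Relaxed {n m : ℕ} (Sxhat : Matrix (Fin n) (Fin n) ℝ) (ρx : ℝ)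
    (Swhat : Matrix (Fin m) (Fin m) ℝ) (ρw : ℝ)
    (k : Matrix (Fin n ⊕ Fin m) (Fin n ⊕ Fin m) ℝ × Matrix (Fin n) (Fin n) ℝ ×
      Matrix (Fin m) (Fin m) ℝ × Matrix (Fin n) (Fin n) ℝ × Matrix (Fin m) (Fin m) ℝ) : Prop where
  psd_S : k.1.PosSemidef
  psd_Sx : k.2.1.PosSemidef
  psd_Sw : k.2.2.1.PosSemidef
  psd_Vx : k.2.2.2.1.PosSemidef
  psd_Vw : k.2.2.2.2.PosSemidef
  block_x : (Matrix.fromBlocks (CFC.sqrt Sxhat * k.2.1 * CFC.sqrt Sxhat)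
    k.2.2.2.1 k.2.2.2.1 1).PosSemidef
  block_w : (Matrix.fromBlocks (CFC.sqrt Swhat * k.2.2.1 * CFC.sqrt Swhat)
    k.2.2.2.2 k.2.2.2.2 1).PosSemidef
  trace_x : ((Matrix.fromBlocks 1 0 0 0 : Matrix (Fin n ⊕ Fin m) (Fin n ⊕ Fin m) ℝ) * k.1).trace
      + (k.2.1 + Sxhat - (2 : ℝ) • k.2.2.2.1).trace ≤ ρx ^ 2
  trace_w : ((Matrix.fromBlocks 0 0 0 1 : Matrix (Fin n ⊕ Fin m) (Fin n ⊕ Fin m) ℝ) * k.1).trace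
      + (k.2.2.1 + Swhat - (2 : ℝ) • k.2.2.2.2).trace ≤ ρw ^ 2

variable {n m : ℕ} {Sxhat : Matrix (Fin n) (Fin n) ℝ} {Swhat : Matrix (Fin m) (Fin m) ℝ} {ρx ρw : ℝ}

lemma isClosed_relaxed : IsClosed {k | Relaxed Sxhat ρx Swhat ρw k} := by
  have : {k | Relaxed Sxhat ρx Swhat ρw k} =
      {k | k.1.PosSemidef ∧ k.2.1.PosSemidef ∧ k.2.2.1.PosSemidef ∧ k.2.2.2.1.PosSemidef ∧
        k.2.2.2.2.PosSemidef ∧ (Matrix.fromBlocks (CFC.sqrt Sxhat * k.2.1 * CFC.sqrt Sxhat)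
          k.2.2.2.1 k.2.2.2.1 1).PosSemidef ∧
        (Matrix.fromBlocks (CFC.sqrt Swhat * k.2.2.1 * CFC.sqrt Swhat)
          k.2.2.2.2 k.2.2.2.2 1).PosSemidef ∧
        ((Matrix.fromBlocks 1 0 0 0 : Matrix (Fin n ⊕ Fin m) (Fin n ⊕ Fin m) ℝ) * k.1).trace
          + (k.2.1 + Sxhat - (2 : ℝ) • k.2.2.2.1).trace ≤ ρx ^ 2 ∧
        ((Matrix.fromBlocks 0 0 0 1 : Matrix (Fin n ⊕ Fin m) (Fin n ⊕ Fin m) ℝ) * k.1).trace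
          + (k.2.2.1 + Swhat - (2 : ℝ) • k.2.2.2.2).trace ≤ ρw ^ 2} := by
    ext k
    exact ⟨fun ⟨h1, h2, h3, h4, h5, h6, h7, h8, h9⟩ => ⟨h1, h2, h3, h4, h5, h6, h7, h8, h9⟩,
      fun ⟨h1, h2, h3, h4, h5, h6, h7, h8, h9⟩ => ⟨h1, h2, h3, h4, h5, h6, h7, h8, h9⟩⟩
  rw [this]
  refine .inter (isClosed_posSemidef.preimage (by fun_prop)) ?_
  refine .inter (isClosed_posSemidef.preimage (by fun_prop)) ?_
  refine .inter (isClosed_posSemidef.preimage (by fun_prop)) ?_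
  refine .inter (isClosed_posSemidef.preimage (by fun_prop)) ?_
  refine .inter (isClosed_posSemidef.preimage (by fun_prop)) ?_
  refine .inter (isClosed_posSemidef.preimage
    (Continuous.matrix_fromBlocks (by fun_prop) (by fun_prop) (by fun_prop) (by fun_prop))) ?_
  refine .inter (isClosed_posSemidef.preimage
    (Continuous.matrix_fromBlocks (by fun_prop) (by fun_prop) (by fun_prop) (by fun_prop))) ?_
  refine .inter ?_ ?_
  all_goals
    change IsClosed {k : Matrix (Fin n ⊕ Fin m) (Fin n ⊕ Fin m) ℝ × Matrix (Fin n) (Fin n) ℝ ×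
      Matrix (Fin m) (Fin m) ℝ × Matrix (Fin n) (Fin n) ℝ × Matrix (Fin m) (Fin m) ℝ |
        (_ : ℝ) ≤ _}
    refine isClosed_le ?_ continuous_const
    refine Continuous.add (Continuous.matrix_trace ?_) (Continuous.matrix_trace ?_) <;> fun_prop

lemma convex_relaxed : Convex ℝ {k | Relaxed Sxhat ρx Swhat ρw k} := by
  intro k hk l hl a b ha hb hab
  have h1 : ∀ {d : ℕ}, a • (1 : Matrix (Fin d) (Fin d) ℝ) + b • 1 = 1 := fun {d} => by
    rw [← add_smul, hab, one_smul]
  refine ⟨PosSemidef.comb hk.psd_S hl.psd_S ha hb, PosSemidef.comb hk.psd_Sx hl.psd_Sx ha hb,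
    PosSemidef.comb hk.psd_Sw hl.psd_Sw ha hb, PosSemidef.comb hk.psd_Vx hl.psd_Vx ha hb,
    PosSemidef.comb hk.psd_Vw hl.psd_Vw ha hb, ?_, ?_, ?_, ?_⟩
  · have := PosSemidef.comb hk.block_x hl.block_x ha hb
    rw [Matrix.fromBlocks_smul, Matrix.fromBlocks_smul, Matrix.fromBlocks_add, h1] at this
    simpa [Matrix.mul_add, Matrix.add_mul] using this
  · have := PosSemidef.comb hk.block_w hl.block_w ha hb
    rw [Matrix.fromBlocks_smul, Matrix.fromBlocks_smul, Matrix.fromBlocks_add, h1] at this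
    simpa [Matrix.mul_add, Matrix.add_mul] using this
  · have e1 := mul_le_mul_of_nonneg_left hk.trace_x ha
    have e2 := mul_le_mul_of_nonneg_left hl.trace_x hb
    simp only [Prod.fst_add, Prod.snd_add, Prod.smul_fst, Prod.smul_snd, Matrix.mul_add,
      Matrix.mul_smul, Matrix.trace_add, Matrix.trace_sub, Matrix.trace_smul, smul_eq_mul] at *
    have e3 : Sxhat.trace = a * Sxhat.trace + b * Sxhat.trace := by rw [← add_mul, hab, one_mul]
    have e4 : ρx ^ 2 = a * ρx ^ 2 + b * ρx ^ 2 := by rw [← add_mul, hab, one_mul]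
    rw [e3, e4]
    linarith
  · have e1 := mul_le_mul_of_nonneg_left hk.trace_w ha
    have e2 := mul_le_mul_of_nonneg_left hl.trace_w hb
    simp only [Prod.fst_add, Prod.snd_add, Prod.smul_fst, Prod.smul_snd, Matrix.mul_add,
      Matrix.mul_smul, Matrix.trace_add, Matrix.trace_sub, Matrix.trace_smul, smul_eq_mul] at *
    have e3 : Swhat.trace = a * Swhat.trace + b * Swhat.trace := by rw [← add_mul, hab, one_mul]
    have e4 : ρw ^ 2 = a * ρw ^ 2 + b * ρw ^ 2 := by rw [← add_mul, hab, one_mul]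
    rw [e3, e4]
    linarith

lemma trace_fst_block_mul (S : Matrix (Fin n ⊕ Fin m) (Fin n ⊕ Fin m) ℝ) :
    ((Matrix.fromBlocks 1 0 0 0 : Matrix (Fin n ⊕ Fin m) (Fin n ⊕ Fin m) ℝ) * S).trace
      = ∑ i, S (Sum.inl i) (Sum.inl i) := by
  have : ∀ i j : Fin n, (1 : Matrix (Fin n) (Fin n) ℝ) i j = if i = j then 1 else 0 :=
    fun i j => Matrix.one_apply
  simp [Matrix.trace, Matrix.mul_apply, Fintype.sum_sum_type, this]

lemma trace_snd_block_mul (S : Matrix (Fin n ⊕ Fin m) (Fin n ⊕ Fin m) ℝ) :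
    ((Matrix.fromBlocks 0 0 0 1 : Matrix (Fin n ⊕ Fin m) (Fin n ⊕ Fin m) ℝ) * S).trace
      = ∑ i, S (Sum.inr i) (Sum.inr i) := by
  have : ∀ i j : Fin m, (1 : Matrix (Fin m) (Fin m) ℝ) i j = if i = j then 1 else 0 :=
    fun i j => Matrix.one_apply
  simp [Matrix.trace, Matrix.mul_apply, Fintype.sum_sum_type, this]

/-- Nonnegativity of `covGap` bounds `s`, and bounds `Tr V` by `(Tr S + Tr Sh) / 2`;
`covGap_lower_bound` at `(1/2, 2)` bounds `Tr S`. The constants are not sharp. -/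
lemma trace_bounds {d : ℕ} {S Sh V : Matrix (Fin d) (Fin d) ℝ} {ρ s : ℝ} (hS : S.PosSemidef)
    (hSh : Sh.PosSemidef) (hV : V.PosSemidef)
    (h : (Matrix.fromBlocks (CFC.sqrt Sh * S * CFC.sqrt Sh) V V 1).PosSemidef)
    (hs : 0 ≤ s) (ht : s + (S + Sh - (2 : ℝ) • V).trace ≤ ρ ^ 2) :
    s ≤ ρ ^ 2 ∧ S.trace ≤ 2 * ρ ^ 2 + 4 * Sh.trace ∧ V.trace ≤ 2 * ρ ^ 2 + 5 * Sh.trace := by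
  have h1 := covGap_le_of_block hS hV h
  have h2 := covGap_nonneg hS hSh
  have h3 := covGap_lower_bound hS hSh (1 / 2) 2 (by norm_num)
  have h4 := hSh.trace_nonneg
  have h5 : (S + Sh - (2 : ℝ) • V).trace = S.trace + Sh.trace - 2 * V.trace := by
    simp [Matrix.trace_add, Matrix.trace_sub, Matrix.trace_smul]
  have h6 := sq_nonneg ρ
  exact ⟨by linarith, by linarith, by linarith⟩

lemma isCompact_relaxed (hSx : Sxhat.PosSemidef) (hSw : Swhat.PosSemidef) :
    IsCompact {k | Relaxed Sxhat ρx Swhat ρw k} := by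
  set r : ℝ := (2 * ρx ^ 2 + 5 * Sxhat.trace) + (2 * ρw ^ 2 + 5 * Swhat.trace) with hr
  refine ((isCompact_box (Fin n ⊕ Fin m) (Fin n ⊕ Fin m) r).prod
    ((isCompact_box (Fin n) (Fin n) r).prod ((isCompact_box (Fin m) (Fin m) r).prod
      ((isCompact_box (Fin n) (Fin n) r).prod (isCompact_box (Fin m) (Fin m) r))))).of_isClosed_subset
    isClosed_relaxed ?_
  intro k hk
  have hk1 := hk.trace_x
  have hk2 := hk.trace_w
  rw [trace_fst_block_mul] at hk1
  rw [trace_snd_block_mul] at hk2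
  obtain ⟨a1, a2, a3⟩ := trace_bounds hk.psd_Sx hSx hk.psd_Vx hk.block_x
    (Finset.sum_nonneg fun i _ => hk.psd_S.diag_nonneg) hk1
  obtain ⟨b1, b2, b3⟩ := trace_bounds hk.psd_Sw hSw hk.psd_Vw hk.block_w
    (Finset.sum_nonneg fun i _ => hk.psd_S.diag_nonneg) hk2
  have hS : k.1.trace = ∑ i, k.1 (Sum.inl i) (Sum.inl i) + ∑ i, k.1 (Sum.inr i) (Sum.inr i) := by
    simp [Matrix.trace, Fintype.sum_sum_type]
  have hx := hSx.trace_nonneg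
  have hw := hSw.trace_nonneg
  have hρx := sq_nonneg ρx
  have hρw := sq_nonneg ρw
  refine ⟨fun i j => (PosSemidef.abs_apply_le_trace hk.psd_S i j).trans (by linarith),
    fun i j => (PosSemidef.abs_apply_le_trace hk.psd_Sx i j).trans (by linarith),
    fun i j => (PosSemidef.abs_apply_le_trace hk.psd_Sw i j).trans (by linarith),
    fun i j => (PosSemidef.abs_apply_le_trace hk.psd_Vx i j).trans (by linarith),
    fun i j => (PosSemidef.abs_apply_le_trace hk.psd_Vw i j).trans (by linarith)⟩

end Relaxation

/-! ### The lifted error and its minimization over `A`. -/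

section Objective

variable {n m : ℕ}

/-- The objective as a linear function of the lifted second-moment matrix. -/
noncomputable def liftedObjective (H : Matrix (Fin m) (Fin n) ℝ) (A : Matrix (Fin n) (Fin m) ℝ)
    (W : Matrix (Fin n ⊕ Fin m) (Fin n ⊕ Fin m) ℝ) : ℝ :=
  (Matrix.fromCols (A * H - 1) A * W * (Matrix.fromCols (A * H - 1) A)ᵀ).trace

lemma liftedObjective_comb (H : Matrix (Fin m) (Fin n) ℝ) (A : Matrix (Fin n) (Fin m) ℝ)
    (W W' : Matrix (Fin n ⊕ Fin m) (Fin n ⊕ Fin m) ℝ) (a b : ℝ) :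
    liftedObjective H A (a • W + b • W') = a * liftedObjective H A W + b * liftedObjective H A W' := by
  simp [liftedObjective, Matrix.mul_add, Matrix.add_mul, Matrix.trace_add, Matrix.trace_smul]

lemma liftedObjective_add (H : Matrix (Fin m) (Fin n) ℝ) (A : Matrix (Fin n) (Fin m) ℝ)
    (W W' : Matrix (Fin n ⊕ Fin m) (Fin n ⊕ Fin m) ℝ) :
    liftedObjective H A (W + W') = liftedObjective H A W + liftedObjective H A W' := by
  simpa using liftedObjective_comb H A W W' 1 1

lemma liftedObjective_fromBlocks (H : Matrix (Fin m) (Fin n) ℝ) (A : Matrix (Fin n) (Fin m) ℝ)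
    (Sx : Matrix (Fin n) (Fin n) ℝ) (Sw : Matrix (Fin m) (Fin m) ℝ) :
    liftedObjective H A (Matrix.fromBlocks Sx 0 0 Sw)
      = ((A * H - 1) * Sx * (A * H - 1)ᵀ + A * Sw * Aᵀ).trace := by
  rw [liftedObjective, Matrix.transpose_fromCols, Matrix.fromCols_mul_fromBlocks,
    Matrix.fromCols_mul_fromRows]
  simp

/-- The gap between the two sides is `a b Tr((X - Y) W (X - Y)ᵀ)`. -/
lemma trace_quadratic_convex {ι κ : Type*} [Fintype ι] [Fintype κ] {W : Matrix ι ι ℝ}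
    (hW : W.PosSemidef) (X Y : Matrix κ ι ℝ) {a b : ℝ} (ha : 0 ≤ a) (hb : 0 ≤ b) (hab : a + b = 1) :
    ((a • X + b • Y) * W * (a • X + b • Y)ᵀ).trace
      ≤ a * (X * W * Xᵀ).trace + b * (Y * W * Yᵀ).trace := by
  have h : 0 ≤ ((X - Y) * W * (X - Y)ᵀ).trace := by
    simpa using (hW.mul_mul_conjTranspose_same (X - Y)).trace_nonneg
  have hab' := mul_nonneg (mul_nonneg ha hb) h
  obtain rfl : b = 1 - a := by linarith
  simp only [Matrix.transpose_add, Matrix.transpose_sub, Matrix.transpose_smul, Matrix.add_mul,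
    Matrix.sub_mul, Matrix.mul_add, Matrix.mul_sub, Matrix.smul_mul, Matrix.mul_smul,
    Matrix.trace_add, Matrix.trace_sub, Matrix.trace_smul, smul_eq_mul] at hab' ⊢
  nlinarith [hab']

lemma convexOn_liftedObjective (H : Matrix (Fin m) (Fin n) ℝ)
    {W : Matrix (Fin n ⊕ Fin m) (Fin n ⊕ Fin m) ℝ} (hW : W.PosSemidef) :
    ConvexOn ℝ Set.univ (fun A => liftedObjective H A W) := by
  refine ⟨convex_univ, fun A _ B _ a b ha hb hab => ?_⟩
  have h1 : Matrix.fromCols ((a • A + b • B) * H - 1) (a • A + b • B)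
      = a • Matrix.fromCols (A * H - 1) A + b • Matrix.fromCols (B * H - 1) B := by
    have : (1 : Matrix (Fin n) (Fin n) ℝ) = a • 1 + b • 1 := by rw [← add_smul, hab, one_smul]
    ext i (j | j)
    · have := congrFun (congrFun this i) j
      simp only [Matrix.fromCols_apply_inl, Matrix.add_mul, Matrix.smul_mul, Matrix.add_apply,
        Matrix.sub_apply, Matrix.smul_apply, smul_eq_mul] at this ⊢
      rw [mul_sub, mul_sub]
      linarith
    · simp
  simp only [liftedObjective, smul_eq_mul]
  rw [h1]
  exact trace_quadratic_convex hW _ _ ha hb hab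

/-- The block matrix sends `(x, w)` to `(x, y)` with `y = H x + w`, and `[-1, A]` sends `(x, y)` to
the error `A y - x`. -/
lemma fromCols_eq_mul (H : Matrix (Fin m) (Fin n) ℝ) (A : Matrix (Fin n) (Fin m) ℝ) :
    Matrix.fromCols (A * H - 1) A = Matrix.fromCols (-1 : Matrix (Fin n) (Fin n) ℝ) A *
      (Matrix.fromBlocks 1 0 H 1 : Matrix (Fin n ⊕ Fin m) (Fin n ⊕ Fin m) ℝ) := by
  rw [Matrix.fromCols_mul_fromBlocks]
  simp [sub_eq_add_neg, add_comm]

lemma liftedObjective_eq (H : Matrix (Fin m) (Fin n) ℝ) (A : Matrix (Fin n) (Fin m) ℝ)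
    (W : Matrix (Fin n ⊕ Fin m) (Fin n ⊕ Fin m) ℝ) :
    liftedObjective H A W = (Matrix.fromCols (-1 : Matrix (Fin n) (Fin n) ℝ) A *
      (Matrix.fromBlocks 1 0 H 1 * W * Matrix.fromBlocks 1 Hᵀ 0 1) *
      (Matrix.fromCols (-1 : Matrix (Fin n) (Fin n) ℝ) A)ᵀ).trace := by
  have : (Matrix.fromBlocks 1 0 H 1 : Matrix (Fin n ⊕ Fin m) (Fin n ⊕ Fin m) ℝ)ᵀ
      = Matrix.fromBlocks 1 Hᵀ 0 1 := by
    simp [Matrix.fromBlocks_transpose]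
  rw [liftedObjective, fromCols_eq_mul, Matrix.transpose_mul, this]
  simp only [Matrix.mul_assoc]

/-- The minimum of the quadratic error over linear estimators is the trace of the generalized Schur
complement. -/
lemma exists_estimator_of_posSemidef {ι κ : Type*} [Fintype ι] [DecidableEq ι] [Fintype κ]
    [DecidableEq κ] {Z : Matrix (ι ⊕ κ) (ι ⊕ κ) ℝ} (hZ : Z.PosSemidef) :
    ∃ (A : Matrix ι κ ℝ) (Q : Matrix ι ι ℝ), Q.IsSymm ∧
      (Z - Matrix.fromBlocks Q 0 0 0).PosSemidef ∧
      (Matrix.fromCols (-1 : Matrix ι ι ℝ) A * Z * (Matrix.fromCols (-1 : Matrix ι ι ℝ) A)ᵀ).trace = Q.trace := by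
  obtain ⟨X, Y, Y', D, rfl⟩ : ∃ X Y Y' D, Z = Matrix.fromBlocks X Y Y' D :=
    ⟨_, _, _, _, (Matrix.fromBlocks_toBlocks Z).symm⟩
  have hZt := PosSemidef.transpose_eq hZ
  rw [Matrix.fromBlocks_transpose, Matrix.fromBlocks_inj] at hZt
  obtain ⟨-, -, rfl, -⟩ := hZt
  have hD : D.PosSemidef := hZ.submatrix (Sum.inr : κ → ι ⊕ κ)
  obtain ⟨P, hP, h1, h2, -⟩ := exists_pseudoInverse hD
  have hPt := PosSemidef.transpose_eq hP
  have hY := mul_pseudoInverse_mul_of_posSemidef hZ h1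
  have hQ := posSemidef_schurComplement hZ hPt h2
  have hY' : D * (P * Yᵀ) = Yᵀ := by
    have := congrArg Matrix.transpose hY
    simpa [Matrix.transpose_mul, hPt, PosSemidef.transpose_eq hD] using this
  -- `Y P` is the least-squares estimator. Removing its residual `Q` from `Z` leaves `[Y P; 1] D [Y
  -- P; 1]ᵀ`, which is positive semidefinite.
  refine ⟨Y * P, X - Y * P * Yᵀ, PosSemidef.transpose_eq hQ, ?_, ?_⟩
  · have := PosSemidef.mul_mul_transpose hD (Matrix.fromRows (Y * P) (1 : Matrix κ κ ℝ))
    convert this using 1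
    rw [Matrix.transpose_fromRows, Matrix.fromRows_mul, Matrix.fromRows_mul_fromCols, sub_eq_add_neg,
      Matrix.fromBlocks_neg, Matrix.fromBlocks_add]
    simp [hY, hPt, Matrix.transpose_mul, hY', Matrix.mul_assoc]
  · rw [Matrix.transpose_fromCols, Matrix.fromCols_mul_fromBlocks, Matrix.fromCols_mul_fromRows, hY]
    simp [hPt, Matrix.transpose_mul, Matrix.mul_assoc, Matrix.trace_add, Matrix.trace_sub]
    ring

end Objective

/-! ### Second moments of affine images. -/

section SecondMoments

variable {Ω : Type*} [MeasurableSpace Ω] {P : Measure Ω} [IsProbabilityMeasure P]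
  {ι κ : Type*} [Fintype ι] [Fintype κ] {X : ι → Ω → ℝ}

/-- The matrix of covariances of a finite family of random variables. -/
noncomputable def covMatrix (X : ι → Ω → ℝ) (P : Measure Ω) : Matrix ι ι ℝ :=
  Matrix.of fun i j => cov[X i, X j; P]

lemma variance_linear_comb (hX : ∀ i, MemLp (X i) 2 P) (a : ι → ℝ) :
    Var[fun ω => ∑ i, a i * X i ω; P] = a ⬝ᵥ covMatrix X P *ᵥ a := by
  rw [variance_fun_sum fun i => (hX i).const_mul (a i)]
  simp only [dotProduct, Matrix.mulVec, covMatrix, Matrix.of_apply, covariance_const_mul_left,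
    covariance_const_mul_right, Finset.mul_sum]
  exact Finset.sum_congr rfl fun i _ => Finset.sum_congr rfl fun j _ => by ring

lemma posSemidef_covMatrix (hX : ∀ i, MemLp (X i) 2 P) : (covMatrix X P).PosSemidef := by
  refine Matrix.PosSemidef.of_dotProduct_mulVec_nonneg ?_ fun a => ?_
  · ext i j
    simp [covMatrix, covariance_comm]
  · rw [star_trivial, ← variance_linear_comb hX]
    exact variance_nonneg _ _

lemma integral_sq_affine (hX : ∀ i, MemLp (X i) 2 P) (a : ι → ℝ) (b : ℝ) :
    ∫ ω, (∑ i, a i * X i ω + b) ^ 2 ∂P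
      = a ⬝ᵥ covMatrix X P *ᵥ a + (∑ i, a i * (∫ ω, X i ω ∂P) + b) ^ 2 := by
  have hS : MemLp (fun ω => ∑ i, a i * X i ω) 2 P :=
    memLp_finsetSum _ fun i _ => (hX i).const_mul (a i)
  have hY : MemLp (fun ω => ∑ i, a i * X i ω + b) 2 P := hS.add (memLp_const b)
  have hi : ∀ i, Integrable (X i) P := fun i => (hX i).integrable one_le_two
  have h1 := variance_eq_sub hY
  rw [variance_add_const hS.aestronglyMeasurable, variance_linear_comb hX] at h1
  have h2 : ∫ ω, (∑ i, a i * X i ω + b) ∂P = ∑ i, a i * (∫ ω, X i ω ∂P) + b := by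
    rw [integral_add (integrable_finsetSum _ fun i _ => (hi i).const_mul _) (integrable_const b),
      integral_finsetSum _ fun i _ => (hi i).const_mul _]
    simp [integral_const_mul]
  rw [h2] at h1
  simp only [Pi.pow_apply] at h1
  linarith

/-- The second moment of an affine image of a random vector. -/
lemma lintegral_enorm_sq_affine (hX : ∀ i, MemLp (X i) 2 P) (A : Matrix κ ι ℝ)
    (b : EuclideanSpace ℝ κ) :
    ∫⁻ ω, ‖WithLp.toLp 2 (A *ᵥ fun i => X i ω) + b‖ₑ ^ 2 ∂P
      = ENNReal.ofReal ((A * covMatrix X P * Aᵀ).trace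
        + ‖WithLp.toLp 2 (A *ᵥ fun i => ∫ ω, X i ω ∂P) + b‖ ^ 2) := by
  have hY : ∀ k, MemLp (fun ω => ∑ i, A k i * X i ω + b k) 2 P := fun k =>
    (memLp_finsetSum _ fun i _ => (hX i).const_mul (A k i)).add (memLp_const (b k))
  have h0 : ∀ ω, ‖WithLp.toLp 2 (A *ᵥ fun i => X i ω) + b‖ₑ ^ 2
      = ENNReal.ofReal (∑ k, (∑ i, A k i * X i ω + b k) ^ 2) := by
    intro ω
    rw [← ofReal_norm, ← ENNReal.ofReal_pow (norm_nonneg _), EuclideanSpace.real_norm_sq_eq]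
    simp [Matrix.mulVec, dotProduct]
  simp_rw [h0]
  rw [← ofReal_integral_eq_lintegral_ofReal
    (integrable_finsetSum _ fun k _ => (hY k).integrable_sq)
    (Filter.Eventually.of_forall fun ω => Finset.sum_nonneg fun k _ => sq_nonneg _)]
  rw [integral_finsetSum _ fun k _ => (hY k).integrable_sq]
  congr 1
  simp_rw [integral_sq_affine hX, Finset.sum_add_distrib]
  congr 1
  · simp only [Matrix.trace, Matrix.diag_apply]
    refine Finset.sum_congr rfl fun k _ => ?_
    rw [Matrix.mul_assoc, Matrix.mul_apply]
    simp only [dotProduct, Matrix.mulVec, Matrix.mul_apply, Matrix.transpose_apply]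
  · rw [EuclideanSpace.real_norm_sq_eq]
    simp [Matrix.mulVec, dotProduct]

end SecondMoments

/-! ### Gaussian distributions and Gelbrich's formula. -/

section Gaussian

set_option linter.unusedSectionVars false

variable {ι κ : Type*} [Fintype ι] [DecidableEq ι] [Fintype κ] [DecidableEq κ]

lemma memLp_eval_multivariateGaussian (μ : EuclideanSpace ℝ ι) (S : Matrix ι ι ℝ) (i : ι) :
    MemLp (fun x : EuclideanSpace ℝ ι => x i) 2 (multivariateGaussian μ S) := by
  have h : MemLp (fun x : EuclideanSpace ℝ ι => x) 2 (multivariateGaussian μ S) :=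
    IsGaussian.memLp_two_id
  exact h.continuousLinearMap_comp (EuclideanSpace.proj i : EuclideanSpace ℝ ι →L[ℝ] ℝ)

lemma integral_eval_multivariateGaussian (μ : EuclideanSpace ℝ ι) (S : Matrix ι ι ℝ) (i : ι) :
    ∫ x : EuclideanSpace ℝ ι, x i ∂(multivariateGaussian μ S) = μ i := by
  have h : Integrable (fun x : EuclideanSpace ℝ ι => x) (multivariateGaussian μ S) :=
    IsGaussian.integrable_id
  have := (EuclideanSpace.proj i : EuclideanSpace ℝ ι →L[ℝ] ℝ).integral_comp_comm h
  simpa using this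

/-- Restriction of coordinates. -/
noncomputable def restrictCoord (e : κ → ι) : EuclideanSpace ℝ ι →L[ℝ] EuclideanSpace ℝ κ :=
  LinearMap.toContinuousLinearMap
    { toFun := fun x => WithLp.toLp 2 fun k => x (e k)
      map_add' := fun _ _ => rfl
      map_smul' := fun _ _ => rfl }

lemma restrictCoord_apply (e : κ → ι) (x : EuclideanSpace ℝ ι) (k : κ) :
    restrictCoord e x k = x (e k) := rfl

/-- The marginals of a Gaussian distribution. -/
lemma map_restrictCoord_multivariateGaussian {S : Matrix ι ι ℝ} (hS : S.PosSemidef)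
    (μ : EuclideanSpace ℝ ι) (e : κ → ι) :
    (multivariateGaussian μ S).map (restrictCoord e)
      = multivariateGaussian (restrictCoord e μ) (S.submatrix e e) := by
  apply IsGaussian.ext
  · simp only [id_eq, integral_id_multivariateGaussian]
    rw [ContinuousLinearMap.integral_id_map, integral_id_multivariateGaussian]
    exact IsGaussian.integrable_id
  rw [← ContinuousLinearMap.toBilinForm_inj]
  refine LinearMap.BilinForm.ext_basis (EuclideanSpace.basisFun κ ℝ).toBasis fun i j ↦ ?_
  rw [ContinuousLinearMap.toBilinForm_apply, ContinuousLinearMap.toBilinForm_apply,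
    covarianceBilin_apply_eq_cov, covariance_map]
  · have (i : κ) : (fun u ↦ inner ℝ ((EuclideanSpace.basisFun κ ℝ).toBasis i) u) ∘
        restrictCoord e = fun u ↦ u (e i) := by
      ext u; simp [PiLp.inner_apply, restrictCoord_apply]
    simp_rw [this, covariance_eval_multivariateGaussian hS,
      covarianceBilin_multivariateGaussian (hS.submatrix _)]
    simp
  any_goals exact Measurable.aestronglyMeasurable (by fun_prop)
  · fun_prop
  · exact IsGaussian.memLp_two_id

lemma covMatrix_multivariateGaussian {S : Matrix ι ι ℝ} (hS : S.PosSemidef)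
    (μ : EuclideanSpace ℝ ι) :
    covMatrix (fun i (x : EuclideanSpace ℝ ι) => x i) (multivariateGaussian μ S) = S := by
  ext i j
  simp [covMatrix, covariance_eval_multivariateGaussian hS]

variable {d : ℕ}

lemma multivariateGaussian_mem_distributions (μ : Vec d) (S : Matrix (Fin d) (Fin d) ℝ) : multivariateGaussian μ S ∈ distributions d := by
  refine ⟨inferInstance, ?_⟩
  have := lintegral_enorm_sq_affine (memLp_eval_multivariateGaussian μ S)
    (1 : Matrix (Fin d) (Fin d) ℝ) 0
  simp only [Matrix.one_mulVec, add_zero] at this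
  exact this ▸ ENNReal.ofReal_lt_top

/-- The mean squared distance under a coupling with given means and covariances. -/
lemma lintegral_coupling {Ω : Type*} [MeasurableSpace Ω] {π : Measure Ω} [IsProbabilityMeasure π]
    {X Y : Ω → Vec d} (hX : ∀ i, MemLp (fun ω => X ω i) 2 π) (hY : ∀ i, MemLp (fun ω => Y ω i) 2 π)
    {μ ν : Vec d} (hμ : ∀ i, ∫ ω, X ω i ∂π = μ i) (hν : ∀ i, ∫ ω, Y ω i ∂π = ν i)
    {S T C : Matrix (Fin d) (Fin d) ℝ}
    (h : covMatrix (Sum.elim (fun i ω => X ω i) fun i ω => Y ω i) π = Matrix.fromBlocks S C Cᵀ T) :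
    ∫⁻ ω, ‖X ω - Y ω‖ₑ ^ 2 ∂π
      = ENNReal.ofReal (‖μ - ν‖ ^ 2 + (S.trace + T.trace - 2 * C.trace)) := by
  have h1 := lintegral_enorm_sq_affine (P := π) (X := Sum.elim (fun i ω => X ω i) fun i ω => Y ω i)
    (by rintro (i | i); exacts [hX i, hY i])
    (Matrix.fromCols (1 : Matrix (Fin d) (Fin d) ℝ) (-1)) 0
  rw [h, Matrix.transpose_fromCols, Matrix.fromCols_mul_fromBlocks,
    Matrix.fromCols_mul_fromRows] at h1
  have h2 : ∀ (x y : Vec d) (f : Fin d ⊕ Fin d → ℝ), (∀ i, f (Sum.inl i) = x i) →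
      (∀ i, f (Sum.inr i) = y i) →
      WithLp.toLp 2 (Matrix.fromCols (1 : Matrix (Fin d) (Fin d) ℝ) (-1) *ᵥ f) = x - y := by
    intro x y f hx hy
    have : f = Sum.elim x.ofLp y.ofLp := by
      ext (i | i)
      exacts [hx i, hy i]
    rw [this, Matrix.fromCols_mulVec_sumElim]
    ext i
    simp [Matrix.neg_mulVec, sub_eq_add_neg]
  simp only [add_zero] at h1
  rw [h2 μ ν _ (fun i => by simpa using hμ i) (fun i => by simpa using hν i)] at h1
  have h3 : ∀ ω, WithLp.toLp 2 (Matrix.fromCols (1 : Matrix (Fin d) (Fin d) ℝ) (-1) *ᵥ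
      fun i => Sum.elim (fun i ω => X ω i) (fun i ω => Y ω i) i ω) = X ω - Y ω :=
    fun ω => h2 _ _ _ (fun _ => rfl) fun _ => rfl
  simp only [h3] at h1
  rw [h1]
  congr 1
  simp [Matrix.trace_add, Matrix.trace_neg]
  ring

lemma rpow_half_le_ofReal {a : ℝ≥0∞} {ρ : ℝ} (hρ : 0 ≤ ρ) :
    a ^ (1 / 2 : ℝ) ≤ ENNReal.ofReal ρ ↔ a ≤ ENNReal.ofReal (ρ ^ 2) := by
  rw [one_div, ENNReal.rpow_inv_le_iff (by norm_num), ENNReal.ofReal_pow hρ, ENNReal.rpow_ofNat]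

/-- The Wasserstein distance between Gaussian distributions (Gelbrich's formula). -/
lemma wasserstein2_multivariateGaussian (μ ν : Vec d) {S T : Matrix (Fin d) (Fin d) ℝ}
    (hS : S.PosSemidef) (hT : T.PosSemidef) :
    wasserstein2 (multivariateGaussian μ S) (multivariateGaussian ν T)
      = ENNReal.ofReal (‖μ - ν‖ ^ 2 + covGap S T) ^ (1 / 2 : ℝ) := by
  apply le_antisymm
  -- The optimal coupling is the joint Gaussian whose cross-covariance has maximal trace.
  · obtain ⟨C, hC, hCt⟩ := exists_cross_trace_eq hS hT
    set m : EuclideanSpace ℝ (Fin d ⊕ Fin d) := WithLp.toLp 2 (Sum.elim μ.ofLp ν.ofLp) with hm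
    set G := multivariateGaussian m (Matrix.fromBlocks S C Cᵀ T) with hG
    have hmeas : Measurable fun x : EuclideanSpace ℝ (Fin d ⊕ Fin d) =>
        (restrictCoord (Sum.inl : Fin d → _) x, restrictCoord (Sum.inr : Fin d → _) x) := by
      fun_prop
    refine iInf₂_le_of_le (G.map fun x => (restrictCoord (Sum.inl : Fin d → _) x,
      restrictCoord (Sum.inr : Fin d → _) x)) ⟨?_, ?_⟩ ?_
    · rw [Measure.map_map measurable_fst hmeas]
      exact map_restrictCoord_multivariateGaussian hC m Sum.inl
    · rw [Measure.map_map measurable_snd hmeas]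
      exact map_restrictCoord_multivariateGaussian hC m Sum.inr
    · rw [lintegral_map (by fun_prop) hmeas]
      have := lintegral_coupling (π := G) (X := fun x => restrictCoord (Sum.inl : Fin d → _) x)
        (Y := fun x => restrictCoord (Sum.inr : Fin d → _) x) (μ := μ) (ν := ν) (S := S) (T := T)
        (C := C) (fun i => memLp_eval_multivariateGaussian _ _ _)
        (fun i => memLp_eval_multivariateGaussian _ _ _)
        (fun i => integral_eval_multivariateGaussian _ _ _)
        (fun i => integral_eval_multivariateGaussian _ _ _)
        (by
          rw [← covMatrix_multivariateGaussian hC m]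
          congr 1
          ext (i | i) x <;> rfl)
      rw [this, covGap_eq, hCt]
  · refine le_iInf₂ fun π hπ => ?_
    obtain ⟨h1, h2⟩ := hπ
    have hprob : IsProbabilityMeasure π := by
      have : IsProbabilityMeasure (π.map Prod.fst) := by rw [h1]; infer_instance
      exact Measure.isProbabilityMeasure_of_map Prod.fst
    have hX : ∀ i, MemLp (fun ω : Vec d × Vec d => ω.1 i) 2 π := fun i =>
      MemLp.comp_of_map (f := Prod.fst) (g := fun x : Vec d => x i)
        (by rw [h1]; exact memLp_eval_multivariateGaussian _ _ _) measurable_fst.aemeasurable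
    have hY : ∀ i, MemLp (fun ω : Vec d × Vec d => ω.2 i) 2 π := fun i =>
      MemLp.comp_of_map (f := Prod.snd) (g := fun x : Vec d => x i)
        (by rw [h2]; exact memLp_eval_multivariateGaussian _ _ _) measurable_snd.aemeasurable
    -- The cost of any coupling depends on it only through the trace of its cross-covariance, which
    -- `trace_cross_le` bounds.
    set C : Matrix (Fin d) (Fin d) ℝ :=
      Matrix.of fun i j => cov[fun ω : Vec d × Vec d => ω.1 i, fun ω => ω.2 j; π] with hC
    have hcov : covMatrix (Sum.elim (fun i (ω : Vec d × Vec d) => ω.1 i) fun i ω => ω.2 i) π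
        = Matrix.fromBlocks S C Cᵀ T := by
      ext (i | i) (j | j)
      · rw [Matrix.fromBlocks_apply₁₁, ← covariance_eval_multivariateGaussian (μ := μ) hS i j, ← h1,
          covariance_map (Measurable.aestronglyMeasurable (by fun_prop))
            (Measurable.aestronglyMeasurable (by fun_prop)) (by fun_prop)]
        rfl
      · rfl
      · exact covariance_comm _ _
      · rw [Matrix.fromBlocks_apply₂₂, ← covariance_eval_multivariateGaussian (μ := ν) hT i j, ← h2,
          covariance_map (Measurable.aestronglyMeasurable (by fun_prop))
            (Measurable.aestronglyMeasurable (by fun_prop)) (by fun_prop)]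
        rfl
    have hpsd : (Matrix.fromBlocks S C Cᵀ T).PosSemidef := by
      rw [← hcov]
      exact posSemidef_covMatrix (by rintro (i | i); exacts [hX i, hY i])
    have hμ : ∀ i, ∫ ω : Vec d × Vec d, ω.1 i ∂π = μ i := fun i => by
      rw [← integral_eval_multivariateGaussian μ S i, ← h1, integral_map (by fun_prop)
        (Measurable.aestronglyMeasurable (by fun_prop))]
    have hν : ∀ i, ∫ ω : Vec d × Vec d, ω.2 i ∂π = ν i := fun i => by
      rw [← integral_eval_multivariateGaussian ν T i, ← h2, integral_map (by fun_prop)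
        (Measurable.aestronglyMeasurable (by fun_prop))]
    rw [lintegral_coupling hX hY hμ hν hcov]
    gcongr
    rw [covGap_eq]
    linarith [trace_cross_le hpsd hS hT]

lemma wasserstein2_multivariateGaussian_le_iff (μ ν : Vec d) {S T : Matrix (Fin d) (Fin d) ℝ}
    (hS : S.PosSemidef) (hT : T.PosSemidef) {ρ : ℝ} (hρ : 0 ≤ ρ) :
    wasserstein2 (multivariateGaussian μ S) (multivariateGaussian ν T) ≤ ENNReal.ofReal ρ
      ↔ MomentFeasible T ρ (μ - ν) S := by
  rw [wasserstein2_multivariateGaussian μ ν hS hT, rpow_half_le_ofReal hρ,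
    ENNReal.ofReal_le_ofReal_iff (sq_nonneg ρ)]
  exact ⟨fun h => ⟨hS, h⟩, fun h => h.2⟩

end Gaussian

/-! ### The mean square error under Gaussian products. -/

section MeanSquareError

variable {n m : ℕ}

/-- The mean square error of an affine estimator under a product of Gaussian distributions. -/
lemma mse_multivariateGaussian (H : Matrix (Fin m) (Fin n) ℝ) (A : Matrix (Fin n) (Fin m) ℝ)
    (b : Vec n) (μx : Vec n) (μw : Vec m) {Sx : Matrix (Fin n) (Fin n) ℝ}
    {Sw : Matrix (Fin m) (Fin m) ℝ} (hSx : Sx.PosSemidef) (hSw : Sw.PosSemidef) :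
    mse H (fun y => act A y + b) ((multivariateGaussian μx Sx).prod (multivariateGaussian μw Sw))
      = ENNReal.ofReal (minimaxObjective H A b μx μw Sx Sw) := by
  set P := (multivariateGaussian μx Sx).prod (multivariateGaussian μw Sw) with hP
  set X : Fin n ⊕ Fin m → Vec n × Vec m → ℝ :=
    Sum.elim (fun i p => p.1 i) fun j p => p.2 j with hXdef
  have hx := memLp_eval_multivariateGaussian μx Sx
  have hw := memLp_eval_multivariateGaussian μw Sw
  have hX : ∀ i, MemLp (X i) 2 P := by
    rintro (i | j)
    · exact (hx i).comp_fst _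
    · exact (hw j).comp_snd _
  -- Independence of `x` and `w` makes the off-diagonal blocks vanish.
  have hcov : covMatrix X P = Matrix.fromBlocks Sx 0 0 Sw := by
    have h1 : P.map Prod.fst = multivariateGaussian μx Sx := by simp [hP]
    have h2 : P.map Prod.snd = multivariateGaussian μw Sw := by simp [hP]
    ext (i | i) (j | j)
    · rw [Matrix.fromBlocks_apply₁₁, ← covariance_eval_multivariateGaussian (μ := μx) hSx i j, ← h1,
        covariance_map (Measurable.aestronglyMeasurable (by fun_prop))
          (Measurable.aestronglyMeasurable (by fun_prop)) (by fun_prop)]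
      rfl
    · exact covariance_fst_snd_prod (hx i) (hw j)
    · exact (covariance_comm _ _).trans (covariance_fst_snd_prod (hx j) (hw i))
    · rw [Matrix.fromBlocks_apply₂₂, ← covariance_eval_multivariateGaussian (μ := μw) hSw i j, ← h2,
        covariance_map (Measurable.aestronglyMeasurable (by fun_prop))
          (Measurable.aestronglyMeasurable (by fun_prop)) (by fun_prop)]
      rfl
  have hmean : (fun i => ∫ p, X i p ∂P) = Sum.elim μx.ofLp μw.ofLp := by
    ext (i | j)
    · exact (integral_fun_fst fun x : Vec n => x i).trans
        (by simp [integral_eval_multivariateGaussian])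
    · exact (integral_fun_snd fun x : Vec m => x j).trans
        (by simp [integral_eval_multivariateGaussian])
  have hpt : ∀ p : Vec n × Vec m, act A (act H p.1 + p.2) + b - p.1
      = WithLp.toLp 2 (Matrix.fromCols (A * H - 1) A *ᵥ fun i => X i p) + b := by
    intro p
    have : (fun i => X i p) = Sum.elim p.1.ofLp p.2.ofLp := by ext (i | j) <;> rfl
    rw [this, Matrix.fromCols_mulVec_sumElim]
    ext i
    simp [act, Matrix.mulVec_add, Matrix.sub_mulVec, Matrix.mulVec_mulVec]
    ring
  rw [mse]
  simp only [hpt]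
  rw [lintegral_enorm_sq_affine hX, hcov, hmean, Matrix.fromCols_mulVec_sumElim, minimaxObjective,
    ← liftedObjective_fromBlocks]
  rfl

end MeanSquareError

/-! ### Equality of the optimal values. -/

section Values

variable {n m : ℕ} {H : Matrix (Fin m) (Fin n) ℝ}
  {Sxhat : Matrix (Fin n) (Fin n) ℝ} {Swhat : Matrix (Fin m) (Fin m) ℝ} {ρx ρw : ℝ}

lemma mem_gaussianBall_iff {d : ℕ} {ν : Vec d} {T : Matrix (Fin d) (Fin d) ℝ}
    (hT : T.PosSemidef) {ρ : ℝ} (hρ : 0 ≤ ρ) {P : Measure (Vec d)} :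
    P ∈ gaussianBall ν T ρ ↔
      ∃ μ S, MomentFeasible T ρ (μ - ν) S ∧ P = multivariateGaussian μ S := by
  constructor
  · rintro ⟨-, hW, μ, S, hS, rfl⟩
    exact ⟨μ, S, (wasserstein2_multivariateGaussian_le_iff μ ν hS hT hρ).1 hW, rfl⟩
  · rintro ⟨μ, S, h, rfl⟩
    exact ⟨multivariateGaussian_mem_distributions μ S,
      (wasserstein2_multivariateGaussian_le_iff μ ν h.1 hT hρ).2 h, μ, S, h.1, rfl⟩

lemma act_neg {k d : ℕ} (A : Matrix (Fin k) (Fin d) ℝ) (x : Vec d) : act A (-x) = -act A x := by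
  simpa using act_smul A (-1) x

lemma act_sub {k d : ℕ} (A : Matrix (Fin k) (Fin d) ℝ) (x y : Vec d) :
    act A (x - y) = act A x - act A y := by
  rw [sub_eq_add_neg, act_add, act_neg, ← sub_eq_add_neg]

/-- Every feasible point of the semidefinite program yields, against every affine estimator, a
feasible point of the inner maximization problem with at least the same objective value. -/
lemma exists_momentFeasible_of_sdpFeasible {Q S Sx Sw Vx Vw}
    (h : SDPFeasible H Sxhat ρx Swhat ρw Q S Sx Sw Vx Vw) (A : Matrix (Fin n) (Fin m) ℝ)
    (b : Vec n) :
    ∃ (μx : Vec n) (μw : Vec m), MomentFeasible Sxhat ρx μx Sx ∧ MomentFeasible Swhat ρw μw Sw ∧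
      Q.trace ≤ minimaxObjective H A b μx μw Sx Sw := by
  obtain ⟨x, w, hx, hw, hxw⟩ := exists_vectors_of_posSemidef (A * H - 1) A h.psd_S
  have hgx := covGap_le_of_block h.psd_Sx h.psd_Vx h.block_x
  have hgw := covGap_le_of_block h.psd_Sw h.psd_Vw h.block_w
  have hQ : Q.trace ≤ liftedObjective H A (Matrix.fromBlocks Sx 0 0 Sw + S) := by
    have h1 := (PosSemidef.mul_mul_transpose h.schur
      (Matrix.fromCols (-1 : Matrix (Fin n) (Fin n) ℝ) A)).trace_nonneg
    rw [Matrix.mul_sub, Matrix.sub_mul, Matrix.trace_sub, ← liftedObjective_eq,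
      Matrix.transpose_fromCols (-1 : Matrix (Fin n) (Fin n) ℝ) A, Matrix.fromCols_mul_fromBlocks,
      Matrix.fromCols_mul_fromRows] at h1
    simpa using h1
  rw [liftedObjective_add, liftedObjective_fromBlocks, liftedObjective] at hQ
  set v := act (A * H - 1) x + act A w with hv
  -- The constraints are even in `(x, w)`, so the sign can be chosen to make the cross term with `b`
  -- nonnegative.
  rcases le_total 0 (inner ℝ v b) with hb | hb
  · refine ⟨x, w, ⟨h.psd_Sx, by linarith [h.trace_x]⟩, ⟨h.psd_Sw, by linarith [h.trace_w]⟩, ?_⟩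
    rw [minimaxObjective, ← hv, norm_add_sq_real]
    linarith [sq_nonneg ‖b‖]
  · refine ⟨-x, -w, ⟨h.psd_Sx, by rw [norm_neg]; linarith [h.trace_x]⟩,
      ⟨h.psd_Sw, by rw [norm_neg]; linarith [h.trace_w]⟩, ?_⟩
    rw [minimaxObjective, act_neg, act_neg, ← neg_add, ← hv, norm_add_sq_real, norm_neg,
      inner_neg_left]
    linarith [sq_nonneg ‖b‖]

lemma norm_act_add_sq (B : Matrix (Fin n) (Fin n) ℝ) (A : Matrix (Fin n) (Fin m) ℝ) (x : Vec n)
    (w : Vec m) :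
    (Matrix.fromCols B A * Matrix.vecMulVec (Sum.elim x.ofLp w.ofLp) (Sum.elim x.ofLp w.ofLp) *
      (Matrix.fromCols B A)ᵀ).trace = ‖act B x + act A w‖ ^ 2 := by
  rw [Matrix.mul_vecMulVec, Matrix.vecMulVec_mul, Matrix.vecMul_transpose, Matrix.trace_vecMulVec,
    Matrix.fromCols_mulVec_sumElim, EuclideanSpace.real_norm_sq_eq]
  simp [dotProduct, act, sq]

/-- A feasible point of the inner maximization problem gives a point of the relaxed feasible set. -/
lemma relaxed_of_momentFeasible {μx : Vec n} {μw : Vec m} {Sx Sw}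
    (hx : MomentFeasible Sxhat ρx μx Sx) (hw : MomentFeasible Swhat ρw μw Sw) :
    Relaxed Sxhat ρx Swhat ρw
      (Matrix.vecMulVec (Sum.elim μx.ofLp μw.ofLp) (Sum.elim μx.ofLp μw.ofLp), Sx, Sw,
        CFC.sqrt (CFC.sqrt Sxhat * Sx * CFC.sqrt Sxhat),
        CFC.sqrt (CFC.sqrt Swhat * Sw * CFC.sqrt Swhat)) where
  psd_S := by simpa using Matrix.posSemidef_vecMulVec_self_star (Sum.elim μx.ofLp μw.ofLp)
  psd_Sx := hx.1
  psd_Sw := hw.1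
  psd_Vx := posSemidef_sqrt _
  psd_Vw := posSemidef_sqrt _
  block_x := posSemidef_block_sqrt (by
    simpa [transpose_sqrt] using PosSemidef.mul_mul_transpose hx.1 (CFC.sqrt Sxhat))
  block_w := posSemidef_block_sqrt (by
    simpa [transpose_sqrt] using PosSemidef.mul_mul_transpose hw.1 (CFC.sqrt Swhat))
  trace_x := by
    have h := hx.2
    rw [covGap_eq, EuclideanSpace.real_norm_sq_eq] at h
    rw [trace_fst_block_mul]
    simpa [Matrix.vecMulVec_apply, ← sq] using h
  trace_w := by
    have h := hw.2
    rw [covGap_eq, EuclideanSpace.real_norm_sq_eq] at h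
    rw [trace_snd_block_mul]
    simpa [Matrix.vecMulVec_apply, ← sq] using h

/-- Strong duality: a value attained against every linear estimator is attained by the
semidefinite program. -/
lemma exists_sdpFeasible (hSx : Sxhat.PosSemidef) (hSw : Swhat.PosSemidef) (c : ℝ)
    (h : ∀ A : Matrix (Fin n) (Fin m) ℝ, ∃ μx μw Sx Sw, MomentFeasible Sxhat ρx μx Sx ∧
      MomentFeasible Swhat ρw μw Sw ∧ c ≤ minimaxObjective H A 0 μx μw Sx Sw) :
    ∃ Q S Sx Sw Vx Vw, SDPFeasible H Sxhat ρx Swhat ρw Q S Sx Sw Vx Vw ∧ c ≤ Q.trace := by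
  have hpsd : ∀ k, Relaxed Sxhat ρx Swhat ρw k →
      (Matrix.fromBlocks k.2.1 0 0 k.2.2.1 + k.1).PosSemidef := by
    intro k hk
    refine Matrix.PosSemidef.add ?_ hk.psd_S
    have h1 := (PosSemidef.mul_mul_transpose hk.psd_Sx (Matrix.fromRows 1 (0 : Matrix (Fin m) _ ℝ))).add
      (PosSemidef.mul_mul_transpose hk.psd_Sw (Matrix.fromRows (0 : Matrix (Fin n) _ ℝ) 1))
    convert h1 using 1
    simp only [Matrix.transpose_fromRows, Matrix.fromRows_mul _ _ k.2.1,
      Matrix.fromRows_mul _ _ k.2.2.1, Matrix.fromRows_mul_fromCols, Matrix.fromBlocks_add]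
    simp
  -- The rank-one lifts of the given responses lie in the relaxed set, where one point `k` then
  -- serves against every `A`.
  obtain ⟨k, hk, hkc⟩ := exists_forall_le_of_forall_exists_le
    (isCompact_relaxed (ρx := ρx) (ρw := ρw) hSx hSw) convex_relaxed
    (fun A k => liftedObjective H A (Matrix.fromBlocks k.2.1 0 0 k.2.2.1 + k.1))
    (fun A => by
      refine Continuous.matrix_trace (Continuous.matrix_mul (Continuous.matrix_mul continuous_const
        (Continuous.add (Continuous.matrix_fromBlocks ?_ ?_ ?_ ?_) ?_)) continuous_const)
      all_goals fun_prop)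
    (fun A k l a b => by
      rw [← liftedObjective_comb]
      congr 1
      simp only [Prod.fst_add, Prod.snd_add, Prod.smul_fst, Prod.smul_snd, smul_add,
        Matrix.fromBlocks_smul, smul_zero]
      rw [add_add_add_comm, Matrix.fromBlocks_add]
      simp)
    (fun k hk => convexOn_liftedObjective H (hpsd k hk)) c (fun A => by
      obtain ⟨μx, μw, Sx, Sw, hx, hw, hc⟩ := h A
      refine ⟨_, relaxed_of_momentFeasible hx hw, ?_⟩
      rw [liftedObjective_add, liftedObjective_fromBlocks, liftedObjective, norm_act_add_sq]
      simpa [minimaxObjective] using hc)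
  have hL : (Matrix.fromBlocks 1 0 H 1 : Matrix (Fin n ⊕ Fin m) (Fin n ⊕ Fin m) ℝ)ᵀ
      = Matrix.fromBlocks 1 Hᵀ 0 1 := by
    simp [Matrix.fromBlocks_transpose]
  obtain ⟨A, Q, hQs, hQ, hQt⟩ := exists_estimator_of_posSemidef
    (PosSemidef.mul_mul_transpose (hpsd k hk)
      (Matrix.fromBlocks 1 0 H 1 : Matrix (Fin n ⊕ Fin m) (Fin n ⊕ Fin m) ℝ))
  rw [hL] at hQ hQt
  refine ⟨Q, k.1, k.2.1, k.2.2.1, k.2.2.2.1, k.2.2.2.2, ⟨hQs, hk.psd_S, hk.psd_Sx, hk.psd_Sw,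
    hk.psd_Vx, hk.psd_Vw, hQ, hk.block_x, hk.block_w, hk.trace_x, hk.trace_w⟩, ?_⟩
  rw [← hQt, ← liftedObjective_eq]
  exact hkc A

lemma le_sdpValue {Q S Sx Sw Vx Vw} (h : SDPFeasible H Sxhat ρx Swhat ρw Q S Sx Sw Vx Vw) :
    ((Q.trace : ℝ) : EReal) ≤ sdpValue H Sxhat ρx Swhat ρw :=
  le_iSup_of_le Q <| le_iSup_of_le S <| le_iSup_of_le Sx <| le_iSup_of_le Sw <|
    le_iSup_of_le Vx <| le_iSup_of_le Vw <| le_iSup_of_le h le_rfl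

/-- The nominal covariance matrices and zero means are feasible. -/
lemma momentFeasible_nominal {d : ℕ} {T : Matrix (Fin d) (Fin d) ℝ} (hT : T.PosSemidef) (ρ : ℝ) :
    MomentFeasible T ρ 0 T := by
  refine ⟨hT, ?_⟩
  have : CFC.sqrt T * T * CFC.sqrt T = T * T := by
    calc CFC.sqrt T * T * CFC.sqrt T
        = CFC.sqrt T * (CFC.sqrt T * CFC.sqrt T) * CFC.sqrt T := by rw [sqrt_mul_sqrt hT]
      _ = (CFC.sqrt T * CFC.sqrt T) * (CFC.sqrt T * CFC.sqrt T) := by simp only [Matrix.mul_assoc]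
      _ = T * T := by rw [sqrt_mul_sqrt hT]
  rw [covGap_eq, this, CFC.sqrt_mul_self T hT.nonneg]
  have := sq_nonneg ρ
  simp
  linarith

lemma minimaxObjective_nonneg (A : Matrix (Fin n) (Fin m) ℝ) (b μx : Vec n) (μw : Vec m)
    {Sx Sw} (hSx : Sx.PosSemidef) (hSw : Sw.PosSemidef) :
    0 ≤ minimaxObjective H A b μx μw Sx Sw := by
  rw [minimaxObjective, Matrix.trace_add]
  have h1 := (PosSemidef.mul_mul_transpose hSx (A * H - 1)).trace_nonneg
  have h2 := (PosSemidef.mul_mul_transpose hSw A).trace_nonneg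
  positivity

/-- Disposes of negative thresholds when comparing with the `ℝ≥0∞`-valued problem. -/
lemma sdpValue_nonneg (hSx : Sxhat.PosSemidef) (hSw : Swhat.PosSemidef) :
    0 ≤ sdpValue H Sxhat ρx Swhat ρw := by
  obtain ⟨Q, S, Sx, Sw, Vx, Vw, h, hQ⟩ := exists_sdpFeasible (H := H) (ρx := ρx) (ρw := ρw)
    hSx hSw 0 fun A => ⟨0, 0, Sxhat, Swhat, momentFeasible_nominal hSx ρx,
      momentFeasible_nominal hSw ρw, minimaxObjective_nonneg A 0 0 0 hSx hSw⟩
  exact le_trans (by exact_mod_cast hQ) (le_sdpValue h)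

theorem minimaxValue_eq_sdpValue (hSx : Sxhat.PosSemidef) (hSw : Swhat.PosSemidef) :
    minimaxValue H Sxhat ρx Swhat ρw = sdpValue H Sxhat ρx Swhat ρw := by
  apply le_antisymm
  -- Working with `c` strictly below the value provides a response of value above `c` without
  -- attainment of the inner supremum.
  · refine EReal.ge_of_forall_gt_iff_ge.1 fun c hc => ?_
    obtain ⟨Q, S, Sx, Sw, Vx, Vw, h, hQ⟩ := exists_sdpFeasible (H := H) (ρx := ρx) (ρw := ρw)
      hSx hSw c fun A => by
        have h1 := hc.trans_le (iInf₂_le A (0 : Vec n))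
        simp only [lt_iSup_iff] at h1
        obtain ⟨μx, μw, Sx, Sw, ⟨hx, hw⟩, hlt⟩ := h1
        exact ⟨μx, μw, Sx, Sw, hx, hw, by exact_mod_cast hlt.le⟩
    exact le_trans (by exact_mod_cast hQ) (le_sdpValue h)
  · refine le_iInf₂ fun A b => ?_
    refine iSup_le fun Q => iSup_le fun S => iSup_le fun Sx => iSup_le fun Sw => iSup_le fun Vx =>
      iSup_le fun Vw => iSup_le fun h => ?_
    obtain ⟨μx, μw, hx, hw, hle⟩ := exists_momentFeasible_of_sdpFeasible h A b
    exact le_iSup_of_le μx <| le_iSup_of_le μw <| le_iSup_of_le Sx <| le_iSup_of_le Sw <|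
      le_iSup_of_le ⟨hx, hw⟩ (by exact_mod_cast hle)

/-- The offset absorbs the nominal means. -/
lemma minimaxObjective_shift (A : Matrix (Fin n) (Fin m) ℝ) (b μx νx : Vec n) (μw νw : Vec m)
    (Sx : Matrix (Fin n) (Fin n) ℝ) (Sw : Matrix (Fin m) (Fin m) ℝ) :
    minimaxObjective H A b μx μw Sx Sw = minimaxObjective H A
      (b + act (A * H - 1) νx + act A νw) (μx - νx) (μw - νw) Sx Sw := by
  simp only [minimaxObjective, act_sub]
  congr 3
  abel

theorem linearGaussianValue_eq_sdpValue (hSx : Sxhat.PosSemidef) (hSw : Swhat.PosSemidef)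
    (νx : Vec n) (νw : Vec m) (hρx : 0 ≤ ρx) (hρw : 0 ≤ ρw) :
    ((linearGaussianValue H νx Sxhat ρx νw Swhat ρw : ℝ≥0∞) : EReal)
      = sdpValue H Sxhat ρx Swhat ρw := by
  apply le_antisymm
  · refine EReal.ge_of_forall_gt_iff_ge.1 fun c hc => ?_
    rcases lt_or_ge c 0 with hneg | hpos
    · exact le_trans (by exact_mod_cast hneg.le) (sdpValue_nonneg hSx hSw)
    have hc' : ENNReal.ofReal c < linearGaussianValue H νx Sxhat ρx νw Swhat ρw := by
      have h1 : (c : EReal) = ((ENNReal.ofReal c : ℝ≥0∞) : EReal) := by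
        rw [EReal.coe_ennreal_ofReal, max_eq_left hpos]
      rw [h1] at hc
      exact_mod_cast hc
    obtain ⟨Q, S, Sx, Sw, Vx, Vw, h, hQ⟩ := exists_sdpFeasible (H := H) (ρx := ρx) (ρw := ρw)
      hSx hSw c fun A => by
        -- The offset that becomes zero after shifting by the nominal means.
        set b : Vec n := -(act (A * H - 1) νx + act A νw) with hb
        have h1 := hc'.trans_le (iInf₂_le (fun y => act A y + b) ⟨A, b, fun _ => rfl⟩)
        simp only [lt_iSup_iff] at h1
        obtain ⟨P, ⟨Px, hPx, Pw, hPw, rfl⟩, hlt⟩ := h1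
        obtain ⟨μx, Sx, hx, rfl⟩ := (mem_gaussianBall_iff hSx hρx).1 hPx
        obtain ⟨μw, Sw, hw, rfl⟩ := (mem_gaussianBall_iff hSw hρw).1 hPw
        rw [mse_multivariateGaussian H A b _ _ hx.1 hw.1,
          minimaxObjective_shift A b μx νx μw νw] at hlt
        have hb0 : b + act (A * H - 1) νx + act A νw = 0 := by rw [hb]; abel
        rw [hb0] at hlt
        exact ⟨_, _, Sx, Sw, hx, hw, (ENNReal.ofReal_lt_ofReal_iff'.1 hlt).1.le⟩
    exact le_trans (by exact_mod_cast hQ) (le_sdpValue h)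
  · refine iSup_le fun Q => iSup_le fun S => iSup_le fun Sx => iSup_le fun Sw => iSup_le fun Vx =>
      iSup_le fun Vw => iSup_le fun h => ?_
    have key : ENNReal.ofReal Q.trace ≤ linearGaussianValue H νx Sxhat ρx νw Swhat ρw := by
      refine le_iInf₂ fun f hf => ?_
      obtain ⟨A, b, hf⟩ := hf
      obtain rfl : f = fun y => act A y + b := funext hf
      obtain ⟨μx, μw, hx, hw, hle⟩ := exists_momentFeasible_of_sdpFeasible h A
        (b + act (A * H - 1) νx + act A νw)
      refine le_iSup₂_of_le ((multivariateGaussian (μx + νx) Sx).prod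
        (multivariateGaussian (μw + νw) Sw)) ⟨_, (mem_gaussianBall_iff hSx hρx).2
          ⟨μx + νx, Sx, by simpa using hx, rfl⟩, _, (mem_gaussianBall_iff hSw hρw).2
          ⟨μw + νw, Sw, by simpa using hw, rfl⟩, rfl⟩ ?_
      rw [mse_multivariateGaussian H A b _ _ hx.1 hw.1,
        minimaxObjective_shift A b (μx + νx) νx (μw + νw) νw, add_sub_cancel_right,
        add_sub_cancel_right]
      exact ENNReal.ofReal_le_ofReal hle
    calc ((Q.trace : ℝ) : EReal) ≤ ((ENNReal.ofReal Q.trace : ℝ≥0∞) : EReal) := by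
          rw [EReal.coe_ennreal_ofReal]
          exact_mod_cast le_max_left _ _
      _ ≤ _ := by exact_mod_cast key

end Values

end WDRE

theorem theorem5 (n m : ℕ) (H : Matrix (Fin m) (Fin n) ℝ)
    (μx : WDRE.Vec n) (μw : WDRE.Vec m)
    (Sxhat : Matrix (Fin n) (Fin n) ℝ) (Swhat : Matrix (Fin m) (Fin m) ℝ)
    (hSx : Sxhat.PosSemidef) (hSw : Swhat.PosSemidef)
    (ρx ρw : ℝ) (hρx : 0 < ρx) (hρw : 0 < ρw) :
    WDRE.minimaxValue H Sxhat ρx Swhat ρw = WDRE.sdpValue H Sxhat ρx Swhat ρw ∧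
    ((WDRE.linearGaussianValue H μx Sxhat ρx μw Swhat ρw : ENNReal) : EReal)
      = WDRE.sdpValue H Sxhat ρx Swhat ρw :=
  ⟨WDRE.minimaxValue_eq_sdpValue hSx hSw,
    WDRE.linearGaussianValue_eq_sdpValue hSx hSw μx μw hρx.le hρw.le⟩
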